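/- Let $N\ge 2$ and $P\ge 1$ be integers, $\xi\in\mathbb R$, $C_e\ge 0$, $\sigma_N\ge 0$ and $t\ge 0$. For $\theta\in[0,2\pi)$ put $a(\theta)=(1,e^{j\xi\sin\theta},\dots,e^{j(N-1)\xi\sin\theta})^{T}\in\mathbb C^{N}$. For $X\in\mathbb C^{N\times P}$ let $$\|X\|_{\tilde{\mathcal A}}=\inf\Big\{\sum_k b_k:\ X=\sum_k b_k(\operatorname{diag}\{e\}+I_N)\,a(\theta_k)\,d_k^{T},\ e\in\mathbb C^N,\ \|e\|_2\le C_e,\ \theta_k\in[0,2\pi),\ d_k\in\mathbb C^P,\ \|d_k\|_2\le 1,\ b_k\ge 0\Big\}$$ (finite sums, with one vector $e$ common to all terms; the infimum of the empty set is $+\infty$), and for $U\in\mathbb C^{N\times P}$ let $$\|U\|^{*}_{\tilde{\mathcal A}}=\sup\{\operatorname{Re}\operatorname{Tr}(U^{H}X):\ \|X\|_{\tilde{\mathcal A}}\le 1\}.$$ Let $\boldsymbol N$ be a random $N\times P$ matrix, regarded as an element of $\mathbb C^{N\times P}$, whose entries are independent real Gaussian random variables with mean zero and variance $\sigma_N^2$.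 Put $$\mathrm{bd}_1=\sqrt2\,\sigma_N\frac{\Gamma((NP+1)/2)}{\Gamma(NP/2)},\qquad \mathrm{bd}_2=(\sqrt N+\sqrt P+t)\,\sigma_N .$$ Then $\|\boldsymbol N\|^{*}_{\tilde{\mathcal A}}$ is almost everywhere measurable and $$\mathbb E\,\|\boldsymbol N\|^{*}_{\tilde{\mathcal A}}\le\min\{\mathrm{bd}_1,\mathrm{bd}_2\}\,C_e+\sigma_N\sqrt{4NP\ln N};$$ moreover the spectral norm (largest singular value) of $\boldsymbol N$ satisfies $\|\boldsymbol N\|_2\le\mathrm{bd}_2$ with probability more than $1-2e^{-t^2/2}$. -/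

import Mathlib

open MeasureTheory ProbabilityTheory
open scoped NNReal ENNReal

noncomputable section

/-- The steering vector `a(θ) = (1, e^{jξ sin θ}, …, e^{j(N-1)ξ sin θ})` of a uniform linear array
with `N` antennas, where `ξ = 2πd/λ`. -/
def steeringVector (N : ℕ) (ξ θ : ℝ) : Fin N → ℂ :=
  fun n => Complex.exp (((n : ℕ) : ℂ) * (ξ : ℂ) * (Real.sin θ : ℂ) * Complex.I)

/-- The gain-phase atom `(diag{e} + I) a(θ) dᵀ`, an `N × P` complex matrix. -/
def gpAtom {N P : ℕ} (ξ : ℝ) (e : EuclideanSpace ℂ (Fin N)) (θ : ℝ)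
    (d : EuclideanSpace ℂ (Fin P)) : Matrix (Fin N) (Fin P) ℂ :=
  Matrix.vecMulVec
    (Matrix.mulVec (Matrix.diagonal (fun n => e n) + 1) (steeringVector N ξ θ)) (fun p => d p)

/-- The gain-phase atomic norm: the infimum of `∑ k, b k` over all finite decompositions
`X = ∑ k, b k (diag{e} + I) a(θ k) (d k)ᵀ` with `‖e‖₂ ≤ Ce` (one `e` common to all the atoms),
`θ k ∈ [0, 2π)`, `‖d k‖₂ ≤ 1`, `b k ≥ 0`.
It takes the value `∞` when there is no such decomposition. -/
def gpAtomicNorm {N P : ℕ} (ξ Ce : ℝ) (X : Matrix (Fin N) (Fin P) ℂ) : ℝ≥0∞ :=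
  sInf {s : ℝ≥0∞ | ∃ (K : ℕ) (e : EuclideanSpace ℂ (Fin N)) (b : Fin K → ℝ≥0)
    (θ : Fin K → ℝ) (d : Fin K → EuclideanSpace ℂ (Fin P)),
      ‖e‖ ≤ Ce ∧ (∀ k, θ k ∈ Set.Ico 0 (2 * Real.pi)) ∧ (∀ k, ‖d k‖ ≤ 1) ∧
      X = ∑ k, ((b k : ℝ) : ℂ) • gpAtom ξ e (θ k) (d k) ∧
      s = ∑ k, (b k : ℝ≥0∞)}

/-- The real inner product `⟨X, U⟩ = Re Tr(Uᴴ X)` of complex matrices. -/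
def matrixInner {N P : ℕ} (X U : Matrix (Fin N) (Fin P) ℂ) : ℝ :=
  (Matrix.trace (U.conjTranspose * X)).re

/-- The dual norm `‖U‖* = sup {⟨X, U⟩ : ‖X‖ ≤ 1}` of the gain-phase atomic norm, with values in
`[0, ∞]`. (For `Ce ≥ 0` the matrix `X = 0` is admissible, so the supremum is nonnegative and
cutting off negative values of `⟨X, U⟩` does not change it.) -/
def gpDualNorm {N P : ℕ} (ξ Ce : ℝ) (U : Matrix (Fin N) (Fin P) ℂ) : ℝ≥0∞ :=
  ⨆ (X : Matrix (Fin N) (Fin P) ℂ) (_ : gpAtomicNorm ξ Ce X ≤ 1),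
    ENNReal.ofReal (matrixInner X U)

open scoped Matrix.Norms.L2Operator in
/-- The spectral norm (largest singular value) of a complex matrix, i.e. its operator norm between
Euclidean spaces. -/
def spectralNormMat {N P : ℕ} (A : Matrix (Fin N) (Fin P) ℂ) : ℝ := ‖A‖

/-- `bd₁ = √2 σ Γ((NP+1)/2) / Γ(NP/2)`. -/
def bdOne (N P : ℕ) (σ : ℝ) : ℝ :=
  √2 * σ * (Real.Gamma (((N : ℝ) * P + 1) / 2) / Real.Gamma ((N : ℝ) * P / 2))

/-- `bd₂ = (√N + √P + t) σ`. -/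
def bdTwo (N P : ℕ) (σ t : ℝ) : ℝ := (√(N : ℝ) + √(P : ℝ) + t) * σ

end

/-! Pairing `U` with an atom gives `Re ((Uᴴ(e ∘ a) + Uᴴ a) · d)`, where `a = a(θ)` and `e ∘ a` is
the entrywise product. The entries of `a` have modulus one, so `‖e ∘ a‖ = ‖e‖ ≤ Ce`, and the dual
norm is at most `‖U‖₂ Ce + sup_θ ‖Uᴴ a(θ)‖` (`gpDualNorm_le`). The two terms are estimated
separately for a standard Gaussian matrix `G` and then scaled by `σ`.

Spectral norm. The Frobenius norm dominates it and has mean `√2 Γ((NP+1)/2)/Γ(NP/2)`, which gives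
`bd₁`. For `bd₂`, Chevet's comparison is run on exponential moments. For unit vectors the process
`uᵀGv + g`, with `g` an independent scalar, is compared with `u·g₁ + v·g₂`, where `g₁`, `g₂` are
independent standard Gaussian vectors. The variances agree, and the covariances are ordered because
`(1 - u·u')(1 - v·v') ≥ 0`. Gaussian interpolation of a smooth maximum
(`integral_expSum_rpow_comparison`) then yields `E exp(l‖G‖₂) ≤ exp(l(√N + √P) + l²/2)`. Markov's
inequality at `l = t` gives the tail, and `l → 0` gives `E‖G‖₂ ≤ √N + √P`.

Steering term. Each column of `G` is the coefficient vector of a polynomial `f` of degree below `N`,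
to be bounded on the unit circle. Parseval applied to `f^k` bounds `sup |f|^(2k)` by the sum of
`|f|^(2k)` over `D = k(N-1)+1` roots of unity, and each summand has mean at most `N^k (2k-1)!!`.
Taking `k` close to `log N` makes the total at most `(4N log N)^k`, so each column contributes at
most `4N log N` in mean square (`exists_column_majorant`). Summing over the `P` columns and taking a
square root by Jensen gives `√(4NP log N)`. For `N ≤ 8` Cauchy-Schwarz is already enough. -/

noncomputable section

/-! ### Standard Gaussian vectors and integration by parts. -/

section GaussianVector

variable {ι : Type*} [Fintype ι]

/-- The standard Gaussian measure on `ι → ℝ`: independent standard Gaussian coordinates. -/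
def piGaussian (ι : Type*) [Fintype ι] : Measure (ι → ℝ) :=
  Measure.pi fun _ : ι => gaussianReal 0 1

instance isProbabilityMeasure_piGaussian : IsProbabilityMeasure (piGaussian ι) := by
  unfold piGaussian; infer_instance

/-- The density of the standard Gaussian measure on `ι → ℝ`. -/
def piGaussianDensity (x : ι → ℝ) : ℝ := ∏ i, gaussianPDFReal 0 1 (x i)

lemma piGaussianDensity_nonneg (x : ι → ℝ) : 0 ≤ piGaussianDensity x :=
  Finset.prod_nonneg fun _ _ => gaussianPDFReal_nonneg _ _ _

lemma measurable_piGaussianDensity : Measurable (piGaussianDensity (ι := ι)) :=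
  Finset.measurable_prod _ fun i _ =>
    (measurable_gaussianPDFReal 0 1).comp (measurable_pi_apply i)

lemma piGaussianDensity_eq (x : ι → ℝ) :
    piGaussianDensity x = (√(2 * Real.pi))⁻¹ ^ Fintype.card ι * Real.exp (-(x ⬝ᵥ x) / 2) := by
  simp only [piGaussianDensity, gaussianPDFReal_def, Finset.prod_mul_distrib, Finset.prod_const,
    Finset.card_univ, ← Real.exp_sum, dotProduct]
  congr 2
  · simp
  · rw [← Finset.sum_neg_distrib, Finset.sum_div]
    refine Finset.sum_congr rfl fun i _ => ?_
    simp; ring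

lemma piGaussian_eq_withDensity :
    piGaussian ι = volume.withDensity fun x => ENNReal.ofReal (piGaussianDensity x) := by
  unfold piGaussian
  symm
  refine (Measure.pi_eq fun s hs => ?_).symm
  have h1 : ∀ i, gaussianReal 0 1 (s i) =
      ENNReal.ofReal (∫ x, (s i).indicator (gaussianPDFReal 0 1) x) := fun i => by
    rw [gaussianReal_apply_eq_integral _ one_ne_zero, integral_indicator (hs i)]
  simp only [h1]
  rw [← ENNReal.ofReal_prod_of_nonneg, ← integral_fintype_prod_volume_eq_prod,
    withDensity_apply _ (MeasurableSet.univ_pi hs),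
    ← ofReal_integral_eq_lintegral_ofReal, ← integral_indicator (MeasurableSet.univ_pi hs)]
  · congr 1
    refine integral_congr_ae (ae_of_all _ fun x => ?_)
    classical
    simp only [Set.indicator_apply, Set.mem_univ_pi, piGaussianDensity]
    split_ifs with h
    · exact Finset.prod_congr rfl fun i _ => by rw [if_pos (h i)]
    · push Not at h
      obtain ⟨i, hi⟩ := h
      exact (Finset.prod_eq_zero (Finset.mem_univ i) (by rw [if_neg hi])).symm
  · exact (Integrable.fintype_prod fun _ => integrable_gaussianPDFReal 0 1).integrableOn
  · exact ae_of_all _ piGaussianDensity_nonneg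
  · exact fun i _ => integral_nonneg fun x =>
      Set.indicator_nonneg (fun y _ => gaussianPDFReal_nonneg _ _ y) x

lemma integral_piGaussian (f : (ι → ℝ) → ℝ) :
    ∫ x, f x ∂piGaussian ι = ∫ x, f x * piGaussianDensity x := by
  rw [piGaussian_eq_withDensity, integral_withDensity_eq_integral_toReal_smul
    measurable_piGaussianDensity.ennreal_ofReal (ae_of_all _ fun _ => ENNReal.ofReal_lt_top)]
  refine integral_congr_ae (ae_of_all _ fun x => ?_)
  simp [ENNReal.toReal_ofReal (piGaussianDensity_nonneg x), mul_comm]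

lemma integrable_piGaussian_iff (f : (ι → ℝ) → ℝ) :
    Integrable f (piGaussian ι) ↔ Integrable fun x => f x * piGaussianDensity x := by
  rw [piGaussian_eq_withDensity, integrable_withDensity_iff
    measurable_piGaussianDensity.ennreal_ofReal (ae_of_all _ fun _ => ENNReal.ofReal_lt_top)]
  simp only [ENNReal.toReal_ofReal (piGaussianDensity_nonneg _)]

lemma integrable_exp_mul_abs_gaussianReal (c : ℝ) :
    Integrable (fun x => Real.exp (c * |x|)) (gaussianReal 0 1) :=
  integrable_exp_mul_abs (X := fun x => x) (integrable_exp_mul_gaussianReal c)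
    (integrable_exp_mul_gaussianReal (-c))

lemma norm_le_sum_abs (x : ι → ℝ) : ‖x‖ ≤ ∑ i, |x i| :=
  (pi_norm_le_iff_of_nonneg (Finset.sum_nonneg fun _ _ => abs_nonneg _)).2 fun i =>
    Finset.single_le_sum (f := fun i => |x i|) (fun _ _ => abs_nonneg _) (Finset.mem_univ i)

lemma integrable_exp_norm_piGaussian {c : ℝ} (hc : 0 ≤ c) :
    Integrable (fun x => Real.exp (c * ‖x‖)) (piGaussian ι) := by
  refine (Integrable.fintype_prod (μ := fun _ : ι => gaussianReal 0 1) fun _ =>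
    integrable_exp_mul_abs_gaussianReal c).mono' (by fun_prop) (ae_of_all _ fun x => ?_)
  rw [Real.norm_of_nonneg (Real.exp_nonneg _), ← Real.exp_sum, ← Finset.mul_sum]
  exact Real.exp_le_exp.2 (mul_le_mul_of_nonneg_left (norm_le_sum_abs x) hc)

/-- A continuous function of at most exponential growth is integrable. -/
lemma integrable_piGaussian_of_le_exp {f : (ι → ℝ) → ℝ} (hf : Continuous f) {K c : ℝ} (hc : 0 ≤ c)
    (h : ∀ x, |f x| ≤ K * Real.exp (c * ‖x‖)) : Integrable f (piGaussian ι) :=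
  ((integrable_exp_norm_piGaussian hc).const_mul K).mono' hf.aestronglyMeasurable
    (ae_of_all _ h)

lemma abs_dotProduct_le (v x : ι → ℝ) : |v ⬝ᵥ x| ≤ (∑ i, |v i|) * ‖x‖ := by
  rw [dotProduct, Finset.sum_mul]
  refine (Finset.abs_sum_le_sum_abs _ _).trans (Finset.sum_le_sum fun i _ => ?_)
  rw [abs_mul]
  exact mul_le_mul_of_nonneg_left (norm_le_pi_norm x i) (abs_nonneg _)

lemma hasLineDerivAt_piGaussianDensity (x v : ι → ℝ) :
    HasLineDerivAt ℝ piGaussianDensity (-(v ⬝ᵥ x) * piGaussianDensity x) x v := by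
  unfold HasLineDerivAt
  simp only [piGaussianDensity_eq]
  have h : HasDerivAt (fun t : ℝ => (x + t • v) ⬝ᵥ (x + t • v)) (2 * (v ⬝ᵥ x)) 0 := by
    have h0 : (fun t : ℝ => (x + t • v) ⬝ᵥ (x + t • v)) =
        fun t => x ⬝ᵥ x + t * (2 * (v ⬝ᵥ x)) + t ^ 2 * (v ⬝ᵥ v) := by
      ext t
      simp only [dotProduct_add, add_dotProduct, dotProduct_smul, smul_dotProduct, smul_eq_mul,
        dotProduct_comm x v]
      ring
    rw [h0]
    refine ((((hasDerivAt_id (0 : ℝ)).mul_const (2 * (v ⬝ᵥ x))).const_add (x ⬝ᵥ x)).add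
      (((hasDerivAt_id (0 : ℝ)).pow 2).mul_const (v ⬝ᵥ v))).congr_deriv ?_
    simp
  refine (((h.neg.div_const 2).exp).const_mul
    ((√(2 * Real.pi))⁻¹ ^ Fintype.card ι)).congr_deriv ?_
  simp only [Pi.neg_apply, zero_smul, add_zero]
  ring

/-- Gaussian integration by parts (Stein's identity). -/
lemma integral_dotProduct_mul_piGaussian {f f' : (ι → ℝ) → ℝ} {v : ι → ℝ} {K c : ℝ} (hc : 0 ≤ c)
    (hf : Continuous f) (hf' : Continuous f')
    (hfb : ∀ x, |f x| ≤ K * Real.exp (c * ‖x‖)) (hfb' : ∀ x, |f' x| ≤ K * Real.exp (c * ‖x‖))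
    (hd : ∀ x, HasLineDerivAt ℝ f (f' x) x v) :
    ∫ x, (v ⬝ᵥ x) * f x ∂piGaussian ι = ∫ x, f' x ∂piGaussian ι := by
  have hK : 0 ≤ K := by simpa using (abs_nonneg _).trans (hfb 0)
  have h1 : Integrable (fun x => (v ⬝ᵥ x) * f x) (piGaussian ι) := by
    refine integrable_piGaussian_of_le_exp (K := (∑ i, |v i|) * K) (c := c + 1)
      (by unfold dotProduct; fun_prop) (by linarith) fun x => ?_
    rw [abs_mul]
    calc |v ⬝ᵥ x| * |f x| ≤ ((∑ i, |v i|) * Real.exp ‖x‖) * (K * Real.exp (c * ‖x‖)) :=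
          mul_le_mul ((abs_dotProduct_le v x).trans (mul_le_mul_of_nonneg_left
            (by linarith [Real.add_one_le_exp ‖x‖]) (Finset.sum_nonneg fun _ _ => abs_nonneg _)))
            (hfb x) (abs_nonneg _) (mul_nonneg (Finset.sum_nonneg fun _ _ => abs_nonneg _)
              (Real.exp_nonneg _))
      _ = _ := by rw [add_mul, one_mul, Real.exp_add]; ring
  have h2 := integrable_piGaussian_of_le_exp hf hc hfb
  have h3 := integrable_piGaussian_of_le_exp hf' hc hfb'
  rw [integrable_piGaussian_iff] at h1 h2 h3
  rw [integral_piGaussian, integral_piGaussian]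
  -- Integration by parts for Lebesgue measure: the derivative of the density along `v` is `-(v ⬝ᵥ
  -- x)` times the density, and integrability of the three products replaces boundary terms.
  have key := integral_bilinear_hasLineDerivAt_right_eq_neg_left_of_integrable (μ := volume)
    (f := f) (f' := f') (g := piGaussianDensity)
    (g' := fun x => -(v ⬝ᵥ x) * piGaussianDensity x) (v := v)
    (B := ContinuousLinearMap.mul ℝ ℝ) (by simpa using h3)
    (by refine h1.neg.congr (ae_of_all _ fun x => ?_)
        simp; ring) (by simpa using h2)
    (fun x _ => hd x) (fun x _ => hasLineDerivAt_piGaussianDensity x v)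
  simp only [ContinuousLinearMap.mul_apply'] at key
  rw [← neg_inj, ← key, ← integral_neg]
  exact integral_congr_ae (ae_of_all _ fun x => by ring)

end GaussianVector

/-! ### The smooth maximum `(∑ exp (β zᵢ))^α` and its derivatives. -/

section SoftMax

variable {I : Type*} [Fintype I]

/-- The sum of exponentials `∑ i, exp (β z i)`. -/
def expSum (β : ℝ) (z : I → ℝ) : ℝ := ∑ i, Real.exp (β * z i)

/-- First partial derivatives of `z ↦ (expSum β z) ^ α`. -/
def expSumGrad (β α : ℝ) (i : I) (z : I → ℝ) : ℝ :=
  α * β * (expSum β z ^ (α - 1) * Real.exp (β * z i))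

/-- Second partial derivatives of `z ↦ (expSum β z) ^ α`. -/
def expSumHess [DecidableEq I] (β α : ℝ) (i j : I) (z : I → ℝ) : ℝ :=
  α * β * β * ((α - 1) * (expSum β z ^ (α - 2) * Real.exp (β * z i) * Real.exp (β * z j)) +
    if i = j then expSum β z ^ (α - 1) * Real.exp (β * z i) else 0)

lemma exp_le_expSum (β : ℝ) (z : I → ℝ) (i : I) : Real.exp (β * z i) ≤ expSum β z :=
  Finset.single_le_sum (f := fun i => Real.exp (β * z i)) (fun _ _ => Real.exp_nonneg _)
    (Finset.mem_univ i)

/-- Lower half of the sandwich `exp (l max z) ≤ (expSum β z)^α ≤ |I|^α exp (l max z)` with `l = αβ`;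
the upper half is `expSum_rpow_le`. For fixed `l` the factor `|I|^α` tends to 1 as `β → ∞`. -/
lemma exp_le_expSum_rpow {β α : ℝ} (hα : 0 ≤ α) (z : I → ℝ) (i : I) :
    Real.exp (α * β * z i) ≤ expSum β z ^ α := by
  refine le_of_eq_of_le ?_ (Real.rpow_le_rpow (Real.exp_nonneg _) (exp_le_expSum β z i) hα)
  rw [← Real.exp_mul]; ring_nf

lemma hasDerivAt_expSum (β : ℝ) {z : ℝ → I → ℝ} {z' : I → ℝ} {t : ℝ}
    (hz : ∀ i, HasDerivAt (fun s => z s i) (z' i) t) :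
    HasDerivAt (fun s => expSum β (z s)) (∑ i, β * (Real.exp (β * z t i) * z' i)) t := by
  unfold expSum
  refine (HasDerivAt.fun_sum fun i _ => ((hz i).const_mul β).exp).congr_deriv ?_
  exact Finset.sum_congr rfl fun i _ => by ring

variable [Nonempty I]

lemma expSum_pos (β : ℝ) (z : I → ℝ) : 0 < expSum β z :=
  Finset.sum_pos (fun _ _ => Real.exp_pos _) Finset.univ_nonempty

lemma expSum_rpow_sub_one_mul (β α : ℝ) (z : I → ℝ) :
    expSum β z ^ (α - 1) * expSum β z = expSum β z ^ α := by
  rw [← Real.rpow_add_one (expSum_pos β z).ne']; ring_nf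

lemma expSum_rpow_sub_two_mul (β α : ℝ) (z : I → ℝ) :
    expSum β z ^ (α - 2) * expSum β z = expSum β z ^ (α - 1) := by
  rw [← Real.rpow_add_one (expSum_pos β z).ne']; ring_nf

lemma expSum_rpow_le {β α : ℝ} (hβ : 0 ≤ β) (hα : 0 ≤ α) {z : I → ℝ} {M : ℝ} (h : ∀ i, z i ≤ M) :
    expSum β z ^ α ≤ (Fintype.card I : ℝ) ^ α * Real.exp (α * β * M) := by
  have : expSum β z ≤ Fintype.card I * Real.exp (β * M) := by
    refine (Finset.sum_le_card_nsmul _ _ _ fun i _ =>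
      Real.exp_le_exp.2 (mul_le_mul_of_nonneg_left (h i) hβ)).trans ?_
    simp
  refine (Real.rpow_le_rpow (expSum_pos β z).le this hα).trans ?_
  rw [Real.mul_rpow (by positivity) (Real.exp_nonneg _), ← Real.exp_mul]
  ring_nf; rfl

lemma expSumGrad_nonneg {β α : ℝ} (hβ : 0 ≤ β) (hα : 0 ≤ α) (i : I) (z : I → ℝ) :
    0 ≤ expSumGrad β α i z := by
  have := expSum_pos β z
  unfold expSumGrad; positivity

lemma expSumGrad_le {β α : ℝ} (hβ : 0 ≤ β) (hα : 0 ≤ α) (i : I) (z : I → ℝ) :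
    expSumGrad β α i z ≤ α * β * expSum β z ^ α := by
  have := expSum_pos β z
  unfold expSumGrad
  rw [← expSum_rpow_sub_one_mul β α z]
  gcongr
  exact exp_le_expSum β z i

lemma abs_expSumHess_le [DecidableEq I] {β α : ℝ} (hβ : 0 ≤ β) (hα : 0 ≤ α) (hα1 : α ≤ 1)
    (i j : I) (z : I → ℝ) :
    |expSumHess β α i j z| ≤ α * β * β * (2 * expSum β z ^ α) := by
  have hS := expSum_pos β z
  have h1 : expSum β z ^ (α - 2) * Real.exp (β * z i) * Real.exp (β * z j) ≤ expSum β z ^ α := by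
    rw [← expSum_rpow_sub_one_mul β α z, ← expSum_rpow_sub_two_mul β α z]
    gcongr <;> apply exp_le_expSum
  have h2 : expSum β z ^ (α - 1) * Real.exp (β * z i) ≤ expSum β z ^ α := by
    rw [← expSum_rpow_sub_one_mul β α z]
    gcongr; apply exp_le_expSum
  unfold expSumHess
  rw [abs_mul, abs_of_nonneg (by positivity : 0 ≤ α * β * β)]
  refine mul_le_mul_of_nonneg_left ?_ (by positivity)
  refine (abs_add_le _ _).trans ?_
  rw [two_mul]
  refine add_le_add ?_ ?_
  · rw [abs_mul, abs_of_nonneg (a := _ * _ * _) (by positivity)]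
    have : |α - 1| ≤ 1 := by rw [abs_le]; constructor <;> linarith
    calc _ ≤ 1 * expSum β z ^ α := by gcongr
      _ = _ := one_mul _
  · split_ifs
    · rwa [abs_of_nonneg (by positivity)]
    · simp; positivity

/-- The sign comes from the factor `α - 1`. It is what makes a one-sided inequality between
off-diagonal covariances sufficient in the comparison. -/
lemma expSumHess_nonpos [DecidableEq I] {β α : ℝ} (hα : 0 ≤ α) (hα1 : α ≤ 1) {i j : I} (hij : i ≠ j)
    (z : I → ℝ) (hβ : 0 ≤ β) : expSumHess β α i j z ≤ 0 := by
  have hS := expSum_pos β z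
  unfold expSumHess
  rw [if_neg hij, add_zero]
  exact mul_nonpos_of_nonneg_of_nonpos (by positivity)
    (mul_nonpos_of_nonpos_of_nonneg (by linarith) (by positivity))

/-- Adding a constant `c` to every coordinate multiplies `(expSum β z)^α` by `exp (αβc)`; the double
sum is the second derivative in `c` at 0. -/
lemma sum_expSumHess [DecidableEq I] (β α : ℝ) (z : I → ℝ) :
    ∑ i, ∑ j, expSumHess β α i j z = (α * β) ^ 2 * expSum β z ^ α := by
  have h : ∀ i, ∑ j, expSumHess β α i j z =
      α * β * β * (α * (expSum β z ^ (α - 1) * Real.exp (β * z i))) := fun i => by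
    unfold expSumHess
    rw [← Finset.mul_sum, Finset.sum_add_distrib, Finset.sum_ite_eq, if_pos (Finset.mem_univ i),
      ← Finset.mul_sum, ← Finset.mul_sum]
    change α * β * β * ((α - 1) * (_ * expSum β z) + _) = _
    rw [← expSum_rpow_sub_two_mul β α z]
    ring
  simp only [h, ← Finset.mul_sum]
  change α * β * β * (α * (_ * expSum β z)) = _
  rw [expSum_rpow_sub_one_mul]; ring

lemma hasDerivAt_expSum_rpow (β α : ℝ) {z : ℝ → I → ℝ} {z' : I → ℝ} {t : ℝ}
    (hz : ∀ i, HasDerivAt (fun s => z s i) (z' i) t) :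
    HasDerivAt (fun s => expSum β (z s) ^ α) (∑ i, expSumGrad β α i (z t) * z' i) t := by
  refine ((hasDerivAt_expSum β hz).rpow_const (Or.inl (expSum_pos β _).ne')).congr_deriv ?_
  rw [Finset.sum_mul, Finset.sum_mul]
  exact Finset.sum_congr rfl fun i _ => by unfold expSumGrad; ring

lemma hasDerivAt_expSumGrad [DecidableEq I] (β α : ℝ) (i : I) {z : ℝ → I → ℝ} {z' : I → ℝ} {t : ℝ}
    (hz : ∀ i, HasDerivAt (fun s => z s i) (z' i) t) :
    HasDerivAt (fun s => expSumGrad β α i (z s)) (∑ j, expSumHess β α i j (z t) * z' j) t := by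
  unfold expSumGrad
  refine (((hasDerivAt_expSum_rpow β (α - 1) hz).mul ((hz i).const_mul β).exp).const_mul
    (α * β)).congr_deriv ?_
  have h1 : ∀ j, expSumHess β α i j (z t) * z' j = α * β * (expSumGrad β (α - 1) j (z t) * z' j *
      Real.exp (β * z t i)) + if i = j then α * β * β * (expSum β (z t) ^ (α - 1) *
        Real.exp (β * z t i)) * z' j else 0 := fun j => by
    unfold expSumHess expSumGrad
    rw [show α - 1 - 1 = α - 2 by ring]
    split_ifs <;> ring
  simp only [h1, Finset.sum_add_distrib, Finset.sum_ite_eq, Finset.mem_univ, if_true]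
  rw [← Finset.mul_sum, ← Finset.sum_mul]
  ring

lemma continuous_expSum_rpow (β α : ℝ) : Continuous fun z : I → ℝ => expSum β z ^ α := by
  have h : Continuous (expSum (I := I) β) := by unfold expSum; fun_prop
  exact h.rpow_const fun z => Or.inl (expSum_pos β z).ne'

lemma continuous_expSumGrad (β α : ℝ) (i : I) : Continuous (expSumGrad β α i) := by
  have := continuous_expSum_rpow (I := I) β (α - 1)
  unfold expSumGrad; fun_prop

lemma continuous_expSumHess [DecidableEq I] (β α : ℝ) (i j : I) :
    Continuous (expSumHess β α i j) := by
  have := continuous_expSum_rpow (I := I) β (α - 1)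
  have := continuous_expSum_rpow (I := I) β (α - 2)
  unfold expSumHess
  split_ifs <;> fun_prop

end SoftMax

/-! ### Gaussian interpolation and the comparison inequality. -/

section Comparison

variable {ι I : Type*} [Fintype ι]

/-- The interpolation `sin θ • X + cos θ • Y` between two linear processes. -/
def interpPath (a b : I → ι → ℝ) (θ : ℝ) (i : I) : ι → ℝ := Real.sin θ • a i + Real.cos θ • b i

/-- The velocity of `interpPath`. -/
def interpVelocity (a b : I → ι → ℝ) (θ : ℝ) (i : I) : ι → ℝ :=
  Real.cos θ • a i - Real.sin θ • b i

lemma hasDerivAt_interpPath (a b : I → ι → ℝ) (θ : ℝ) (i : I) (x : ι → ℝ) :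
    HasDerivAt (fun s => interpPath a b s i ⬝ᵥ x) (interpVelocity a b θ i ⬝ᵥ x) θ := by
  simp only [interpPath, interpVelocity, add_dotProduct, sub_dotProduct, smul_dotProduct,
    smul_eq_mul]
  refine (((Real.hasDerivAt_sin θ).mul_const _).add
    ((Real.hasDerivAt_cos θ).mul_const _)).congr_deriv ?_
  ring

/-- The cross terms vanish because `a` and `b` are orthogonal, that is, the two processes are
independent. -/
lemma interpPath_dotProduct_interpVelocity {a b : I → ι → ℝ} (hab : ∀ i j, a i ⬝ᵥ b j = 0)
    (θ : ℝ) (i j : I) : interpPath a b θ j ⬝ᵥ interpVelocity a b θ i =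
      Real.sin θ * Real.cos θ * (a i ⬝ᵥ a j - b i ⬝ᵥ b j) := by
  simp only [interpPath, interpVelocity, add_dotProduct, dotProduct_sub, smul_dotProduct,
    dotProduct_smul, smul_eq_mul, hab, dotProduct_comm (b j) (a i), dotProduct_comm (a j) (a i),
    dotProduct_comm (b j) (b i)]
  ring

lemma continuous_dotProduct_family (c : I → ι → ℝ) :
    Continuous fun (x : ι → ℝ) (i : I) => c i ⬝ᵥ x := by
  unfold dotProduct; fun_prop

variable [Fintype I]

/-- A Lipschitz bound for the linear functionals along the interpolation. -/
def interpBound (a b : I → ι → ℝ) : ℝ := ∑ i, (∑ k, |a i k| + ∑ k, |b i k|)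

lemma interpBound_nonneg (a b : I → ι → ℝ) : 0 ≤ interpBound a b := by
  unfold interpBound; positivity

lemma abs_mul_add_mul_le_interpBound (a b : I → ι → ℝ) {s c : ℝ} (hs : |s| ≤ 1) (hc : |c| ≤ 1)
    (i : I) (x : ι → ℝ) : |s * (a i ⬝ᵥ x) + c * (b i ⬝ᵥ x)| ≤ interpBound a b * ‖x‖ := by
  have h1 : ∑ k, |a i k| + ∑ k, |b i k| ≤ interpBound a b :=
    Finset.single_le_sum (f := fun i => ∑ k, |a i k| + ∑ k, |b i k|)
      (fun _ _ => by positivity) (Finset.mem_univ i)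
  refine le_trans ?_ (mul_le_mul_of_nonneg_right h1 (norm_nonneg x))
  refine (abs_add_le _ _).trans ?_
  rw [abs_mul, abs_mul, add_mul]
  have h2 := abs_dotProduct_le (a i) x
  have h3 := abs_dotProduct_le (b i) x
  exact add_le_add ((mul_le_of_le_one_left (abs_nonneg _) hs).trans h2)
    ((mul_le_of_le_one_left (abs_nonneg _) hc).trans h3)

lemma abs_interpPath_le (a b : I → ι → ℝ) (θ : ℝ) (i : I) (x : ι → ℝ) :
    |interpPath a b θ i ⬝ᵥ x| ≤ interpBound a b * ‖x‖ := by
  simpa only [interpPath, add_dotProduct, smul_dotProduct, smul_eq_mul] using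
    abs_mul_add_mul_le_interpBound a b (Real.abs_sin_le_one θ) (Real.abs_cos_le_one θ) i x

lemma abs_interpVelocity_le (a b : I → ι → ℝ) (θ : ℝ) (i : I) (x : ι → ℝ) :
    |interpVelocity a b θ i ⬝ᵥ x| ≤ interpBound a b * ‖x‖ := by
  have := abs_mul_add_mul_le_interpBound a b (Real.abs_cos_le_one θ)
    (c := -Real.sin θ) (by simpa using Real.abs_sin_le_one θ) i x
  simpa only [interpVelocity, sub_dotProduct, smul_dotProduct, smul_eq_mul, neg_mul,
    ← sub_eq_add_neg] using this

variable [Nonempty I]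

lemma expSum_interpPath_rpow_le (a b : I → ι → ℝ) {β α : ℝ} (hβ : 0 ≤ β) (hα : 0 ≤ α) (θ : ℝ)
    (x : ι → ℝ) : expSum β (fun i => interpPath a b θ i ⬝ᵥ x) ^ α ≤
      (Fintype.card I : ℝ) ^ α * Real.exp (α * β * interpBound a b * ‖x‖) := by
  rw [mul_assoc (α * β)]
  exact expSum_rpow_le hβ hα fun i => (le_abs_self _).trans (abs_interpPath_le a b θ i x)

lemma integrable_expSum_rpow (c : I → ι → ℝ) {β α : ℝ} (hβ : 0 ≤ β) (hα : 0 ≤ α) :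
    Integrable (fun x => expSum β (fun i => c i ⬝ᵥ x) ^ α) (piGaussian ι) := by
  have h := interpBound_nonneg c 0
  refine integrable_piGaussian_of_le_exp
    ((continuous_expSum_rpow β α).comp (continuous_dotProduct_family c))
    (K := (Fintype.card I : ℝ) ^ α) (c := α * β * interpBound c 0) (by positivity) fun x => ?_
  rw [abs_of_nonneg (Real.rpow_nonneg (expSum_pos _ _).le _)]
  simpa [interpPath] using expSum_interpPath_rpow_le c 0 hβ hα (Real.pi / 2) x

lemma integrable_expSumHess [DecidableEq I] (c : I → ι → ℝ) {β α : ℝ} (hβ : 0 ≤ β) (hα : 0 ≤ α)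
    (hα1 : α ≤ 1) (i j : I) :
    Integrable (fun x => expSumHess β α i j (fun i => c i ⬝ᵥ x)) (piGaussian ι) :=
  (((integrable_expSum_rpow c hβ hα).const_mul 2).const_mul (α * β * β)).mono'
    ((continuous_expSumHess β α i j).comp (continuous_dotProduct_family c)).aestronglyMeasurable
    (ae_of_all _ fun _ => abs_expSumHess_le hβ hα hα1 i j _)

/-- Gaussian integration by parts for the gradient of the soft maximum. -/
lemma integral_expSumGrad_mul [DecidableEq I] (c : I → ι → ℝ) {β α : ℝ} (hβ : 0 ≤ β) (hα : 0 ≤ α)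
    (hα1 : α ≤ 1) (i : I) (v : ι → ℝ) :
    ∫ x, expSumGrad β α i (fun i => c i ⬝ᵥ x) * (v ⬝ᵥ x) ∂piGaussian ι =
      ∑ j, (c j ⬝ᵥ v) * ∫ x, expSumHess β α i j (fun i => c i ⬝ᵥ x) ∂piGaussian ι := by
  have h0 := interpBound_nonneg c 0
  have hF : ∀ x : ι → ℝ, expSum β (fun i => c i ⬝ᵥ x) ^ α ≤ (Fintype.card I : ℝ) ^ α *
      Real.exp (α * β * interpBound c 0 * ‖x‖) := fun x => by
    simpa [interpPath] using expSum_interpPath_rpow_le c 0 hβ hα (Real.pi / 2) x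
  have hF0 : ∀ x : ι → ℝ, 0 ≤ expSum β (fun i => c i ⬝ᵥ x) ^ α := fun x =>
    Real.rpow_nonneg (expSum_pos _ _).le _
  set K : ℝ := (α * β + ∑ j, α * β * β * 2 * |c j ⬝ᵥ v|) * (Fintype.card I : ℝ) ^ α with hK
  have key := integral_dotProduct_mul_piGaussian (v := v)
    (f := fun x => expSumGrad β α i (fun i => c i ⬝ᵥ x))
    (f' := fun x => ∑ j, expSumHess β α i j (fun i => c i ⬝ᵥ x) * (c j ⬝ᵥ v))
    (K := K) (c := α * β * interpBound c 0) (by positivity)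
    ((continuous_expSumGrad β α i).comp (continuous_dotProduct_family c))
    (continuous_finsetSum _ fun j _ => ((continuous_expSumHess β α i j).comp
      (continuous_dotProduct_family c)).mul continuous_const)
    (fun x => ?_) (fun x => ?_) (fun x => ?_)
  · simp only [mul_comm (expSumGrad _ _ _ _)]
    rw [key, integral_finsetSum _ fun j _ =>
      (integrable_expSumHess c hβ hα hα1 i j).mul_const _]
    exact Finset.sum_congr rfl fun j _ => by rw [integral_mul_const, mul_comm]
  · rw [abs_of_nonneg (expSumGrad_nonneg hβ hα i _), hK, mul_assoc]
    refine (expSumGrad_le hβ hα i _).trans ?_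
    refine mul_le_mul ?_ (hF x) (hF0 x) (by positivity)
    have : 0 ≤ ∑ j, α * β * β * 2 * |c j ⬝ᵥ v| := by positivity
    linarith
  · rw [hK, mul_assoc]
    refine (Finset.abs_sum_le_sum_abs _ _).trans ?_
    have h1 : ∀ j, |expSumHess β α i j (fun i => c i ⬝ᵥ x) * (c j ⬝ᵥ v)| ≤
        (α * β * β * 2 * |c j ⬝ᵥ v|) * expSum β (fun i => c i ⬝ᵥ x) ^ α := fun j => by
      rw [abs_mul]
      refine (mul_le_mul_of_nonneg_right (abs_expSumHess_le hβ hα hα1 i j _)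
        (abs_nonneg _)).trans (le_of_eq (by ring))
    refine (Finset.sum_le_sum fun j _ => h1 j).trans ?_
    rw [← Finset.sum_mul]
    refine mul_le_mul ?_ (hF x) (hF0 x) (by positivity)
    have : 0 ≤ α * β := by positivity
    linarith
  · unfold HasLineDerivAt
    have := hasDerivAt_expSumGrad β α i (t := 0) (z := fun t i => c i ⬝ᵥ (x + t • v))
      (z' := fun i => c i ⬝ᵥ v) fun i => by
        simp only [dotProduct_add, dotProduct_smul, smul_eq_mul]
        simpa using ((hasDerivAt_id (0 : ℝ)).mul_const (c i ⬝ᵥ v)).const_add (c i ⬝ᵥ x)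
    simpa using this

lemma hasDerivAt_integral_interpPath [DecidableEq I] {a b : I → ι → ℝ}
    (hab : ∀ i j, a i ⬝ᵥ b j = 0) {β α : ℝ} (hβ : 0 ≤ β) (hα : 0 ≤ α) (hα1 : α ≤ 1) (θ : ℝ) :
    HasDerivAt (fun θ => ∫ x, expSum β (fun i => interpPath a b θ i ⬝ᵥ x) ^ α ∂piGaussian ι)
      (∑ i, ∑ j, Real.sin θ * Real.cos θ * (a i ⬝ᵥ a j - b i ⬝ᵥ b j) *
        ∫ x, expSumHess β α i j (fun i => interpPath a b θ i ⬝ᵥ x) ∂piGaussian ι) θ := by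
  have h0 := interpBound_nonneg a b
  have hbd : ∀ (θ : ℝ) (x : ι → ℝ) (i : I),
      |expSumGrad β α i (fun i => interpPath a b θ i ⬝ᵥ x) * (interpVelocity a b θ i ⬝ᵥ x)| ≤
        (α * β * (Fintype.card I : ℝ) ^ α * interpBound a b) *
          Real.exp ((α * β * interpBound a b + 1) * ‖x‖) := fun θ x i => by
    rw [abs_mul, abs_of_nonneg (expSumGrad_nonneg hβ hα i _)]
    calc _ ≤ (α * β * ((Fintype.card I : ℝ) ^ α * Real.exp (α * β * interpBound a b * ‖x‖))) *
          (interpBound a b * Real.exp ‖x‖) := by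
          refine mul_le_mul ((expSumGrad_le hβ hα i _).trans (mul_le_mul_of_nonneg_left
            (expSum_interpPath_rpow_le a b hβ hα θ x) (by positivity)))
            ((abs_interpVelocity_le a b θ i x).trans (mul_le_mul_of_nonneg_left
              (by linarith [Real.add_one_le_exp ‖x‖]) h0)) (abs_nonneg _) (by positivity)
      _ = _ := by rw [add_mul, one_mul, Real.exp_add]; ring
  have hcont : ∀ θ i, Continuous fun x : ι → ℝ =>
      expSumGrad β α i (fun i => interpPath a b θ i ⬝ᵥ x) * (interpVelocity a b θ i ⬝ᵥ x) :=
    fun θ i => ((continuous_expSumGrad β α i).comp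
      (continuous_dotProduct_family (interpPath a b θ))).mul
        (by unfold dotProduct; fun_prop)
  have key := hasDerivAt_integral_of_dominated_loc_of_deriv_le (μ := piGaussian ι)
    (F := fun θ x => expSum β (fun i => interpPath a b θ i ⬝ᵥ x) ^ α)
    (F' := fun θ x => ∑ i, expSumGrad β α i (fun i => interpPath a b θ i ⬝ᵥ x) *
      (interpVelocity a b θ i ⬝ᵥ x)) (x₀ := θ) (s := Set.univ) Filter.univ_mem
    (bound := fun x => ∑ i : I, (α * β * (Fintype.card I : ℝ) ^ α * interpBound a b) *
          Real.exp ((α * β * interpBound a b + 1) * ‖x‖))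
    (Filter.Eventually.of_forall fun θ => ((continuous_expSum_rpow β α).comp
      (continuous_dotProduct_family (interpPath a b θ))).aestronglyMeasurable)
    (integrable_expSum_rpow _ hβ hα)
    (continuous_finsetSum _ fun i _ => hcont θ i).aestronglyMeasurable
    (ae_of_all _ fun x θ _ => (norm_sum_le _ _).trans (Finset.sum_le_sum fun i _ => hbd θ x i))
    (integrable_finsetSum _ fun i _ =>
      (integrable_exp_norm_piGaussian (by positivity)).const_mul _)
    (ae_of_all _ fun x θ _ => hasDerivAt_expSum_rpow β α fun i => hasDerivAt_interpPath a b θ i x)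
  refine key.2.congr_deriv ?_
  rw [integral_finsetSum _ fun i _ => integrable_piGaussian_of_le_exp (hcont θ i)
    (by positivity) fun x => hbd θ x i]
  refine Finset.sum_congr rfl fun i _ => ?_
  rw [integral_expSumGrad_mul (interpPath a b θ) hβ hα hα1]
  exact Finset.sum_congr rfl fun j _ => by rw [interpPath_dotProduct_interpVelocity hab]

/-- A comparison inequality for the exponential moments of the soft maxima of two Gaussian
processes whose increments satisfy Chevet's condition. -/
theorem integral_expSum_rpow_comparison {a b : I → ι → ℝ} (hab : ∀ i j, a i ⬝ᵥ b j = 0)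
    (hle : ∀ i j, b i ⬝ᵥ b j ≤ 1 + a i ⬝ᵥ a j) (heq : ∀ i, b i ⬝ᵥ b i = 1 + a i ⬝ᵥ a i)
    {β α : ℝ} (hβ : 0 ≤ β) (hα : 0 ≤ α) (hα1 : α ≤ 1) :
    Real.exp ((α * β) ^ 2 / 2) * ∫ x, expSum β (fun i => a i ⬝ᵥ x) ^ α ∂piGaussian ι ≤
      ∫ x, expSum β (fun i => b i ⬝ᵥ x) ^ α ∂piGaussian ι := by
  classical
  set H := fun θ => ∫ x, expSum β (fun i => interpPath a b θ i ⬝ᵥ x) ^ α ∂piGaussian ι with hH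
  set R := fun θ i j =>
    ∫ x, expSumHess β α i j (fun i => interpPath a b θ i ⬝ᵥ x) ∂piGaussian ι with hR
  have hsum : ∀ θ, (α * β) ^ 2 * H θ = ∑ i, ∑ j, R θ i j := fun θ => by
    simp only [hH, hR, ← integral_const_mul, ← sum_expSumHess]
    rw [integral_finsetSum _ fun i _ => integrable_finsetSum _ fun j _ =>
      integrable_expSumHess _ hβ hα hα1 i j]
    exact Finset.sum_congr rfl fun i _ => integral_finsetSum _ fun j _ =>
      integrable_expSumHess _ hβ hα hα1 i j
  -- The exponential factor is the moment `E exp (αβ sin θ g)` of an independent standard Gaussian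
  -- `g`: it adds `sin θ g` to the process without enlarging the space. By `hsum` this adds the
  -- constant 1 to each covariance difference.
  have hd : ∀ θ, HasDerivAt (fun θ => Real.exp ((α * β) ^ 2 / 2 * Real.sin θ ^ 2) * H θ)
      (Real.exp ((α * β) ^ 2 / 2 * Real.sin θ ^ 2) * (Real.sin θ * Real.cos θ *
        ∑ i, ∑ j, (1 + a i ⬝ᵥ a j - b i ⬝ᵥ b j) * R θ i j)) θ := fun θ => by
    refine (((((Real.hasDerivAt_sin θ).pow 2).const_mul ((α * β) ^ 2 / 2)).exp).mul
      (hasDerivAt_integral_interpPath hab hβ hα hα1 θ)).congr_deriv ?_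
    have : ∑ i, ∑ j, (1 + a i ⬝ᵥ a j - b i ⬝ᵥ b j) * R θ i j = (α * β) ^ 2 * H θ +
        ∑ i, ∑ j, (a i ⬝ᵥ a j - b i ⬝ᵥ b j) * R θ i j := by
      rw [hsum, ← Finset.sum_add_distrib]
      refine Finset.sum_congr rfl fun i _ => ?_
      rw [← Finset.sum_add_distrib]
      exact Finset.sum_congr rfl fun j _ => by ring
    rw [this]
    simp only [mul_assoc (Real.sin θ * Real.cos θ), ← Finset.mul_sum]
    simp only [Nat.cast_ofNat, Nat.add_one_sub_one, pow_one, Pi.pow_apply]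
    ring
  have hanti : AntitoneOn (fun θ => Real.exp ((α * β) ^ 2 / 2 * Real.sin θ ^ 2) * H θ)
      (Set.Icc 0 (Real.pi / 2)) := by
    refine antitoneOn_of_deriv_nonpos (convex_Icc _ _)
      (fun θ _ => (hd θ).continuousAt.continuousWithinAt)
      (fun θ _ => (hd θ).differentiableAt.differentiableWithinAt) fun θ hθ => ?_
    rw [interior_Icc] at hθ
    rw [(hd θ).deriv]
    have hs : 0 ≤ Real.sin θ := Real.sin_nonneg_of_nonneg_of_le_pi hθ.1.le
      (by linarith [hθ.2, Real.pi_pos])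
    have hc : 0 ≤ Real.cos θ :=
      Real.cos_nonneg_of_mem_Icc ⟨by linarith [hθ.1, Real.pi_pos], hθ.2.le⟩
    refine mul_nonpos_of_nonneg_of_nonpos (Real.exp_nonneg _)
      (mul_nonpos_of_nonneg_of_nonpos (mul_nonneg hs hc) ?_)
    refine Finset.sum_nonpos fun i _ => Finset.sum_nonpos fun j _ => ?_
    -- Diagonal terms vanish by equality of variances. Off the diagonal a nonnegative covariance
    -- difference meets a nonpositive second derivative.
    rcases eq_or_ne i j with rfl | hij
    · rw [heq]; simp
    · exact mul_nonpos_of_nonneg_of_nonpos (by linarith [hle i j])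
        (integral_nonpos fun x => expSumHess_nonpos hα hα1 hij _ hβ)
  have hp := Real.pi_pos.le
  have := hanti (a := 0) (b := Real.pi / 2) ⟨le_rfl, by positivity⟩ ⟨by positivity, le_rfl⟩
    (by positivity)
  simpa [hH, interpPath] using this

end Comparison

/-! ### Exponential moments of the norm of a Gaussian vector. -/

section ChiMoment

variable {ι : Type*} [Fintype ι]

/-- No condition on `a` is needed: for `a ≥ 1/2` both sides take the default value 0. Conversely, a
nonzero right side proves integrability in the next lemma. -/
lemma integral_exp_mul_sq_gaussianReal {a : ℝ} :
    ∫ x, Real.exp (a * x ^ 2) ∂gaussianReal 0 1 = √(1 / (1 - 2 * a)) := by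
  rw [integral_gaussianReal_eq_integral_smul one_ne_zero]
  have h : ∀ x : ℝ, gaussianPDFReal 0 1 x • Real.exp (a * x ^ 2) =
      (√(2 * Real.pi))⁻¹ * Real.exp (-(1 / 2 - a) * x ^ 2) := fun x => by
    rw [gaussianPDFReal_def, smul_eq_mul, mul_assoc, ← Real.exp_add]
    simp only [NNReal.coe_one, mul_one, sub_zero]
    ring_nf
  simp only [h]
  rw [integral_const_mul, integral_gaussian, ← Real.sqrt_inv, ← Real.sqrt_mul (by positivity)]
  congr 1
  have := Real.pi_ne_zero
  rw [show 1 / 2 - a = (1 - 2 * a) / 2 by ring]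
  by_cases h0 : 1 - 2 * a = 0
  · simp [h0]
  · field_simp

lemma integrable_exp_mul_sq_gaussianReal {a : ℝ} (ha : a < 1 / 2) :
    Integrable (fun x => Real.exp (a * x ^ 2)) (gaussianReal 0 1) := by
  have h := integral_exp_mul_sq_gaussianReal (a := a)
  refine Integrable.of_integral_ne_zero ?_
  rw [h]
  have : 0 < 1 - 2 * a := by linarith
  positivity

lemma exp_mul_dotProduct_self (a : ℝ) (x : ι → ℝ) :
    Real.exp (a * (x ⬝ᵥ x)) = ∏ i, Real.exp (a * x i ^ 2) := by
  rw [← Real.exp_sum, ← Finset.mul_sum]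
  simp only [dotProduct, pow_two]

lemma continuous_sqrt_dotProduct_self : Continuous fun x : ι → ℝ => √(x ⬝ᵥ x) := by
  unfold dotProduct; fun_prop

/-- A linear function is dominated by a quadratic one. -/
lemma exp_mul_sqrt_le {l a : ℝ} (ha : 0 < a) (x : ι → ℝ) :
    Real.exp (l * √(x ⬝ᵥ x)) ≤ Real.exp (l ^ 2 / (4 * a)) * Real.exp (a * (x ⬝ᵥ x)) := by
  rw [← Real.exp_add, Real.exp_le_exp]
  have h0 : 0 ≤ x ⬝ᵥ x := by
    unfold dotProduct; exact Finset.sum_nonneg fun i _ => mul_self_nonneg _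
  have h := Real.sq_sqrt h0
  set r := √(x ⬝ᵥ x)
  rw [← h]
  have : l ^ 2 / (4 * a) + a * r ^ 2 - l * r = (l - 2 * a * r) ^ 2 / (4 * a) := by
    field_simp; ring
  have : 0 ≤ (l - 2 * a * r) ^ 2 / (4 * a) := by positivity
  linarith

lemma integrable_exp_mul_dotProduct_self {a : ℝ} (ha : a < 1 / 2) :
    Integrable (fun x => Real.exp (a * (x ⬝ᵥ x))) (piGaussian ι) := by
  simp only [exp_mul_dotProduct_self]
  exact Integrable.fintype_prod fun _ => integrable_exp_mul_sq_gaussianReal ha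

lemma integrable_exp_mul_sqrt (l : ℝ) :
    Integrable (fun x => Real.exp (l * √(x ⬝ᵥ x))) (piGaussian ι) := by
  refine ((integrable_exp_mul_dotProduct_self (by norm_num : (1 / 4 : ℝ) < 1 / 2)).const_mul
    (Real.exp (l ^ 2 / (4 * (1 / 4))))).mono'
    (by have := continuous_sqrt_dotProduct_self (ι := ι); fun_prop) (ae_of_all _ fun x => ?_)
  rw [Real.norm_of_nonneg (Real.exp_nonneg _)]
  exact exp_mul_sqrt_le (by norm_num) x

/-- The exponential moments of the Euclidean norm of a standard Gaussian vector. -/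
lemma integral_exp_mul_sqrt_le [Nonempty ι] {l : ℝ} (hl : 0 ≤ l) :
    ∫ x, Real.exp (l * √(x ⬝ᵥ x)) ∂piGaussian ι ≤
      Real.exp (l * √(Fintype.card ι) + l ^ 2 / 2) := by
  rcases hl.eq_or_lt with rfl | hl
  · simp
  set s := √(Fintype.card ι : ℝ) with hs
  have hs0 : 0 < s := Real.sqrt_pos.2 (by exact_mod_cast Fintype.card_pos)
  have hss : s ^ 2 = Fintype.card ι := Real.sq_sqrt (by positivity)
  -- With this coefficient `a`, the constant `l²/(4a)` equals `ls/2 + l²/2` and `(1 - 2a)⁻¹ = 1 +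
  -- l/s`. The moment of `exp (a‖x‖²)` is then at most `exp (ls/2)`, which gives exactly the claimed
  -- exponent.
  have ha : 0 < l / (2 * (s + l)) := by positivity
  have h12 : 1 - 2 * (l / (2 * (s + l))) = s / (s + l) := by field_simp; ring
  have ha2 : l / (2 * (s + l)) < 1 / 2 := by
    have : 0 < s / (s + l) := by positivity
    linarith
  have h1 : ∫ x, Real.exp (l * √(x ⬝ᵥ x)) ∂piGaussian ι ≤
      Real.exp (l ^ 2 / (4 * (l / (2 * (s + l))))) * √(1 + l / s) ^ Fintype.card ι := by
    refine (integral_mono (integrable_exp_mul_sqrt l)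
      ((integrable_exp_mul_dotProduct_self ha2).const_mul _)
      fun x => exp_mul_sqrt_le ha x).trans (le_of_eq ?_)
    rw [integral_const_mul]
    congr 1
    simp only [exp_mul_dotProduct_self]
    rw [piGaussian, integral_fintype_prod_eq_pow (f := fun y : ℝ =>
      Real.exp (l / (2 * (s + l)) * y ^ 2)), integral_exp_mul_sq_gaussianReal, h12]
    congr 2
    field_simp
  have h2 : √(1 + l / s) ≤ Real.exp (l / s / 2) := by
    rw [Real.exp_half]
    exact Real.sqrt_le_sqrt (by linarith [Real.add_one_le_exp (l / s)])
  refine h1.trans ((mul_le_mul_of_nonneg_left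
    (pow_le_pow_left₀ (Real.sqrt_nonneg _) h2 _) (Real.exp_nonneg _)).trans (le_of_eq ?_))
  rw [← Real.exp_nat_mul, ← Real.exp_add, ← hss]
  congr 1
  field_simp
  ring

end ChiMoment

/-! ### Independence of disjoint blocks of coordinates. -/

section SumType

variable {m n : Type*} [Fintype m] [Fintype n]

lemma measurePreserving_piGaussian_sum :
    MeasurePreserving (fun x : m ⊕ n → ℝ => ((fun i => x (.inl i), fun j => x (.inr j)) :
      (m → ℝ) × (n → ℝ))) (piGaussian (m ⊕ n)) ((piGaussian m).prod (piGaussian n)) :=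
  measurePreserving_sumPiEquivProdPi fun _ : m ⊕ n => gaussianReal 0 1

lemma integral_piGaussian_sum_inl {f : (m → ℝ) → ℝ} (hf : Continuous f) :
    ∫ x, f (fun i => x (.inl i)) ∂piGaussian (m ⊕ n) = ∫ x, f x ∂piGaussian m := by
  have h : MeasurePreserving (fun x : m ⊕ n → ℝ => fun i => x (.inl i))
      (piGaussian (m ⊕ n)) (piGaussian m) :=
    measurePreserving_fst.comp measurePreserving_piGaussian_sum
  rw [← h.map_eq, integral_map h.measurable.aemeasurable hf.aestronglyMeasurable]

lemma integral_piGaussian_sum_inr {f : (n → ℝ) → ℝ} (hf : Continuous f) :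
    ∫ x, f (fun i => x (.inr i)) ∂piGaussian (m ⊕ n) = ∫ x, f x ∂piGaussian n := by
  have h : MeasurePreserving (fun x : m ⊕ n → ℝ => fun i => x (.inr i))
      (piGaussian (m ⊕ n)) (piGaussian n) :=
    measurePreserving_snd.comp measurePreserving_piGaussian_sum
  rw [← h.map_eq, integral_map h.measurable.aemeasurable hf.aestronglyMeasurable]

lemma integral_piGaussian_sum_mul {f : (m → ℝ) → ℝ} {g : (n → ℝ) → ℝ} (hf : Continuous f)
    (hg : Continuous g) :
    ∫ x, f (fun i => x (.inl i)) * g (fun j => x (.inr j)) ∂piGaussian (m ⊕ n) =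
      (∫ x, f x ∂piGaussian m) * ∫ x, g x ∂piGaussian n := by
  rw [← integral_prod_mul, ← (measurePreserving_piGaussian_sum (m := m) (n := n)).map_eq,
    integral_map measurePreserving_piGaussian_sum.measurable.aemeasurable
      (by fun_prop)]

lemma integrable_piGaussian_sum_mul {f : (m → ℝ) → ℝ} {g : (n → ℝ) → ℝ}
    (hf : Integrable f (piGaussian m)) (hg : Integrable g (piGaussian n)) :
    Integrable (fun x => f (fun i => x (.inl i)) * g (fun j => x (.inr j)))
      (piGaussian (m ⊕ n)) := by
  have h := measurePreserving_piGaussian_sum (m := m) (n := n)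
  exact h.integrable_comp_of_integrable (hf.mul_prod hg)

end SumType

/-! ### Chevet's inequality for bilinear forms. -/

section Chevet

variable {m n I : Type*} [Fintype m] [Fintype n] [Fintype I]

/-- The bilinear form `uᵀ X v` of a matrix given by its entries. -/
def bilinEntry (u : m → ℝ) (v : n → ℝ) (x : m × n → ℝ) : ℝ := (fun k => u k.1 * v k.2) ⬝ᵥ x

lemma dotProduct_le_sqrt {u : m → ℝ} (hu : u ⬝ᵥ u = 1) (g : m → ℝ) : u ⬝ᵥ g ≤ √(g ⬝ᵥ g) := by
  have := Real.sum_mul_le_sqrt_mul_sqrt Finset.univ u g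
  simp only [dotProduct] at hu ⊢
  simpa only [pow_two, hu, Real.sqrt_one, one_mul] using this

lemma tensor_dotProduct_tensor (u u' : m → ℝ) (v v' : n → ℝ) :
    (fun k : m × n => u k.1 * v k.2) ⬝ᵥ (fun k => u' k.1 * v' k.2) = (u ⬝ᵥ u') * (v ⬝ᵥ v') := by
  simp only [dotProduct, Finset.sum_mul_sum, Fintype.sum_prod_type]
  exact Finset.sum_congr rfl fun i _ => Finset.sum_congr rfl fun j _ => by ring

lemma integrable_expSum_bilinEntry [Nonempty I] (u : I → m → ℝ) (v : I → n → ℝ) {β α : ℝ}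
    (hβ : 0 ≤ β) (hα : 0 ≤ α) :
    Integrable (fun x => expSum β (fun i => bilinEntry (u i) (v i) x) ^ α)
      (piGaussian (m × n)) := by
  unfold bilinEntry
  exact integrable_expSum_rpow (fun i (k : m × n) => u i k.1 * v i k.2) hβ hα

lemma continuous_expSum_bilinEntry [Nonempty I] (u : I → m → ℝ) (v : I → n → ℝ) (β α : ℝ) :
    Continuous fun x => expSum β (fun i => bilinEntry (u i) (v i) x) ^ α := by
  unfold bilinEntry
  exact (continuous_expSum_rpow β α).comp
    (continuous_dotProduct_family fun i (k : m × n) => u i k.1 * v i k.2)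

/-- **Chevet's inequality** for the exponential moments of the soft maximum of the bilinear form of
a standard Gaussian matrix over finitely many pairs of unit vectors. -/
lemma integral_expSum_bilinEntry_le [Nonempty m] [Nonempty n] [Nonempty I] {u : I → m → ℝ}
    {v : I → n → ℝ} (hu : ∀ i, u i ⬝ᵥ u i = 1) (hv : ∀ i, v i ⬝ᵥ v i = 1) {β α : ℝ} (hβ : 0 ≤ β)
    (hα : 0 ≤ α) (hα1 : α ≤ 1) :
    ∫ x, expSum β (fun i => bilinEntry (u i) (v i) x) ^ α ∂piGaussian (m × n) ≤
      (Fintype.card I : ℝ) ^ α * Real.exp (α * β * (√(Fintype.card m) + √(Fintype.card n)) +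
        (α * β) ^ 2 / 2) := by
  -- Disjoint blocks of one Gaussian vector carry the matrix and the two comparison vectors, so `a`
  -- and `b` are orthogonal.
  set a : I → (m × n) ⊕ (m ⊕ n) → ℝ := fun i => Sum.elim (fun k => u i k.1 * v i k.2) 0 with ha
  set b : I → (m × n) ⊕ (m ⊕ n) → ℝ := fun i => Sum.elim 0 (Sum.elim (u i) (v i)) with hb
  have hle1 : ∀ i j, u i ⬝ᵥ u j ≤ 1 := fun i j => by
    simpa [hu] using dotProduct_le_sqrt (hu i) (u j)
  have hle2 : ∀ i j, v i ⬝ᵥ v j ≤ 1 := fun i j => by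
    simpa [hv] using dotProduct_le_sqrt (hv i) (v j)
  have key := integral_expSum_rpow_comparison (a := a) (b := b) (β := β) (α := α)
    (fun i j => by simp [ha, hb])
    (fun i j => by
      simp only [ha, hb, sumElim_dotProduct_sumElim, tensor_dotProduct_tensor, zero_dotProduct]
      -- This is `(1 - u·u')(1 - v·v') ≥ 0`.
      nlinarith [hle1 i j, hle2 i j])
    (fun i => by
      simp only [ha, hb, sumElim_dotProduct_sumElim, tensor_dotProduct_tensor, zero_dotProduct, hu,
        hv]
      norm_num) hβ hα hα1
  have hA : ∫ x, expSum β (fun i => a i ⬝ᵥ x) ^ α ∂piGaussian ((m × n) ⊕ (m ⊕ n)) =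
      ∫ x, expSum β (fun i => bilinEntry (u i) (v i) x) ^ α ∂piGaussian (m × n) := by
    rw [← integral_piGaussian_sum_inl (n := m ⊕ n) (continuous_expSum_bilinEntry u v β α)]
    refine integral_congr_ae (ae_of_all _ fun x => ?_)
    have : ∀ i, a i ⬝ᵥ x = bilinEntry (u i) (v i) fun k => x (.inl k) := fun i => by
      simp [ha, bilinEntry, dotProduct]
    simp only [this]
  have hE1 := integral_exp_mul_sqrt_le (ι := m) (l := α * β) (by positivity)
  have hE2 := integral_exp_mul_sqrt_le (ι := n) (l := α * β) (by positivity)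
  have hcm : Continuous fun x : m → ℝ => Real.exp (α * β * √(x ⬝ᵥ x)) := by
    have := continuous_sqrt_dotProduct_self (ι := m); fun_prop
  have hcn : Continuous fun x : n → ℝ => Real.exp (α * β * √(x ⬝ᵥ x)) := by
    have := continuous_sqrt_dotProduct_self (ι := n); fun_prop
  have hB : ∫ x, expSum β (fun i => b i ⬝ᵥ x) ^ α ∂piGaussian ((m × n) ⊕ (m ⊕ n)) ≤
      (Fintype.card I : ℝ) ^ α * ((∫ x, Real.exp (α * β * √(x ⬝ᵥ x)) ∂piGaussian m) *
        ∫ x, Real.exp (α * β * √(x ⬝ᵥ x)) ∂piGaussian n) := by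
    have hint := integrable_piGaussian_sum_mul (integrable_exp_mul_sqrt (ι := m) (α * β))
      (integrable_exp_mul_sqrt (ι := n) (α * β))
    rw [← integral_piGaussian_sum_mul hcm hcn, ← integral_piGaussian_sum_inr (m := m × n)
      (f := fun x : m ⊕ n → ℝ =>
        Real.exp (α * β * √((fun i => x (.inl i)) ⬝ᵥ fun i => x (.inl i))) *
        Real.exp (α * β * √((fun i => x (.inr i)) ⬝ᵥ fun i => x (.inr i)))) (by fun_prop),
      ← integral_const_mul]
    refine integral_mono (integrable_expSum_rpow b hβ hα) (Integrable.const_mul ?_ _) fun x => ?_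
    · simpa using integrable_piGaussian_sum_mul (f := fun _ : m × n → ℝ => (1 : ℝ))
        (integrable_const _) hint
    · simp only
      rw [← Real.exp_add, ← mul_add]
      refine expSum_rpow_le hβ hα fun i => ?_
      have : b i ⬝ᵥ x = u i ⬝ᵥ (fun k => x (.inr (.inl k))) +
          v i ⬝ᵥ (fun k => x (.inr (.inr k))) := by
        simp [hb, dotProduct]
      rw [this]
      exact add_le_add (dotProduct_le_sqrt (hu i) _) (dotProduct_le_sqrt (hv i) _)
  rw [hA] at key
  have h0 : 0 ≤ ∫ x, Real.exp (α * β * √(x ⬝ᵥ x)) ∂piGaussian n :=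
    integral_nonneg fun _ => Real.exp_nonneg _
  have h1 := key.trans (hB.trans (mul_le_mul_of_nonneg_left
    (mul_le_mul hE1 hE2 h0 (Real.exp_nonneg _)) (by positivity)))
  -- The two norm moments contribute `exp (l²/2)` each, with `l = αβ`; the comparison factor cancels
  -- one of them.
  rw [← le_div_iff₀' (Real.exp_pos _)] at h1
  refine h1.trans (le_of_eq ?_)
  rw [mul_div_assoc, ← Real.exp_add, ← Real.exp_sub]
  ring_nf

/-- Chevet's inequality for the exponential moments of the maximum over finitely many pairs. -/
lemma lintegral_iSup_exp_bilinEntry_le [Nonempty m] [Nonempty n] [Nonempty I] {u : I → m → ℝ}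
    {v : I → n → ℝ} (hu : ∀ i, u i ⬝ᵥ u i = 1) (hv : ∀ i, v i ⬝ᵥ v i = 1) {l : ℝ} (hl : 0 < l) :
    ∫⁻ x, ⨆ i, ENNReal.ofReal (Real.exp (l * bilinEntry (u i) (v i) x)) ∂piGaussian (m × n) ≤
      ENNReal.ofReal (Real.exp (l * (√(Fintype.card m) + √(Fintype.card n)) + l ^ 2 / 2)) := by
  set B := Real.exp (l * (√(Fintype.card m) + √(Fintype.card n)) + l ^ 2 / 2) with hB
  have hc : (Fintype.card I : ℝ) ≠ 0 := by exact_mod_cast Fintype.card_ne_zero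
  -- The choice `α = l / β` keeps `αβ = l` while `β → ∞` removes the cardinality of the index set,
  -- so the bound passes to infinite families.
  have hlim : Filter.Tendsto (fun β : ℝ => ENNReal.ofReal ((Fintype.card I : ℝ) ^ (l / β) * B))
      Filter.atTop (nhds (ENNReal.ofReal B)) := by
    refine ENNReal.tendsto_ofReal ?_
    have h1 : Filter.Tendsto (fun β : ℝ => l / β) Filter.atTop (nhds 0) :=
      Filter.Tendsto.div_atTop tendsto_const_nhds Filter.tendsto_id
    have h2 := (tendsto_const_nhds (x := (Fintype.card I : ℝ))).rpow h1 (Or.inl hc)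
    simpa using h2.mul_const B
  refine ge_of_tendsto hlim ?_
  filter_upwards [Filter.eventually_ge_atTop l] with β hβl
  have hβ : 0 < β := hl.trans_le hβl
  have hα : 0 ≤ l / β := by positivity
  have hlβ : l / β * β = l := by field_simp
  have h := integral_expSum_bilinEntry_le hu hv hβ.le hα ((div_le_one hβ).2 hβl)
  rw [hlβ] at h
  refine le_trans ?_ (ENNReal.ofReal_le_ofReal h)
  rw [ofReal_integral_eq_lintegral_ofReal (integrable_expSum_bilinEntry u v hβ.le hα)
    (ae_of_all _ fun x => Real.rpow_nonneg (expSum_pos _ _).le _)]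
  refine lintegral_mono fun x => iSup_le fun i => ENNReal.ofReal_le_ofReal ?_
  have := exp_le_expSum_rpow (β := β) hα (fun i => bilinEntry (u i) (v i) x) i
  rwa [hlβ] at this

lemma continuous_bilinEntry (u : m → ℝ) (v : n → ℝ) : Continuous (bilinEntry u v) := by
  unfold bilinEntry dotProduct; fun_prop

/-- Chevet's inequality for the exponential moments of the supremum over a sequence of pairs. -/
lemma lintegral_iSup_nat_exp_bilinEntry_le [Nonempty m] [Nonempty n] {u : ℕ → m → ℝ}
    {v : ℕ → n → ℝ} (hu : ∀ i, u i ⬝ᵥ u i = 1) (hv : ∀ i, v i ⬝ᵥ v i = 1) {l : ℝ} (hl : 0 < l) :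
    ∫⁻ x, ⨆ i, ENNReal.ofReal (Real.exp (l * bilinEntry (u i) (v i) x)) ∂piGaussian (m × n) ≤
      ENNReal.ofReal (Real.exp (l * (√(Fintype.card m) + √(Fintype.card n)) + l ^ 2 / 2)) := by
  have h : ∀ x : m × n → ℝ, ⨆ i, ENNReal.ofReal (Real.exp (l * bilinEntry (u i) (v i) x)) =
      ⨆ k : ℕ, ⨆ i : Fin (k + 1), ENNReal.ofReal (Real.exp (l * bilinEntry (u i) (v i) x)) :=
    fun x => le_antisymm
      (iSup_le fun i => le_iSup_of_le i (le_iSup_of_le (Fin.last i) (by simp)))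
      (iSup_le fun k => iSup_le fun i => le_iSup_of_le (i : ℕ) le_rfl)
  simp only [h]
  rw [lintegral_iSup]
  · exact iSup_le fun k => lintegral_iSup_exp_bilinEntry_le (I := Fin (k + 1))
      (u := fun i => u i) (v := fun i => v i) (fun i => hu i) (fun i => hv i) hl
  · intro k
    refine Measurable.iSup fun i => ?_
    have := (continuous_bilinEntry (u i) (v i)).measurable
    fun_prop
  · intro k k' hk x
    exact iSup_le fun i => le_iSup_of_le (Fin.castLE (by omega) i) le_rfl

end Chevet

/-! ### Tail and mean of the spectral norm. -/

section SpectralNorm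

variable {N P : ℕ}

/-- The complex matrix with real entries `x`. -/
def entryMatrix (x : Fin N × Fin P → ℝ) : Matrix (Fin N) (Fin P) ℂ :=
  fun n p => (x (n, p) : ℂ)

lemma continuous_entryMatrix : Continuous (entryMatrix (N := N) (P := P)) := by
  unfold entryMatrix
  exact continuous_pi fun n => continuous_pi fun p =>
    Complex.continuous_ofReal.comp (continuous_apply (n, p))

open scoped Matrix.Norms.L2Operator in
lemma continuous_spectralNormMat : Continuous (spectralNormMat (N := N) (P := P)) :=
  continuous_norm

open scoped Matrix.Norms.L2Operator in
lemma spectralNormMat_nonneg (A : Matrix (Fin N) (Fin P) ℂ) : 0 ≤ spectralNormMat A :=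
  norm_nonneg A

open scoped Matrix.Norms.L2Operator in
lemma spectralNormMat_smul (c : ℝ) (A : Matrix (Fin N) (Fin P) ℂ) :
    spectralNormMat ((c : ℂ) • A) = |c| * spectralNormMat A := by
  unfold spectralNormMat
  rw [norm_smul, Complex.norm_real, Real.norm_eq_abs]

open scoped Matrix.Norms.L2Operator in
lemma norm_mulVec_le_spectralNormMat (A : Matrix (Fin N) (Fin P) ℂ) (z : Fin P → ℂ) :
    ‖WithLp.toLp 2 (A.mulVec z)‖ ≤ spectralNormMat A * ‖WithLp.toLp 2 z‖ :=
  A.l2_opNorm_mulVec (WithLp.toLp 2 z)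

open scoped Matrix.Norms.L2Operator in
lemma spectralNormMat_conjTranspose (A : Matrix (Fin N) (Fin P) ℂ) :
    spectralNormMat A.conjTranspose = spectralNormMat A :=
  A.l2_opNorm_conjTranspose

open scoped Matrix.Norms.L2Operator in
lemma spectralNormMat_le_of_forall {A : Matrix (Fin N) (Fin P) ℂ} {M : ℝ} (hM : 0 ≤ M)
    (h : ∀ z : Fin P → ℂ, ‖WithLp.toLp 2 (A.mulVec z)‖ ≤ M * ‖WithLp.toLp 2 z‖) :
    spectralNormMat A ≤ M := by
  unfold spectralNormMat
  rw [Matrix.l2_opNorm_def]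
  exact ContinuousLinearMap.opNorm_le_bound _ hM fun z => h z.ofLp

lemma real_dotProduct_self_nonneg {ι : Type*} [Fintype ι] (x : ι → ℝ) : 0 ≤ x ⬝ᵥ x :=
  Finset.sum_nonneg fun _ _ => mul_self_nonneg _

lemma bilinEntry_eq (u : Fin N → ℝ) (v : Fin P → ℝ) (x : Fin N × Fin P → ℝ) :
    bilinEntry u v x = u ⬝ᵥ fun n => ∑ p, x (n, p) * v p := by
  simp only [bilinEntry, dotProduct, Fintype.sum_prod_type, Finset.mul_sum]
  exact Finset.sum_congr rfl fun i _ => Finset.sum_congr rfl fun j _ => by ring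

lemma dotProduct_mulVec_self_le {x : Fin N × Fin P → ℝ} {M : ℝ}
    (h : ∀ (u : Fin N → ℝ) (v : Fin P → ℝ), u ⬝ᵥ u = 1 → v ⬝ᵥ v = 1 → bilinEntry u v x ≤ M)
    (v : Fin P → ℝ) :
    (fun n => ∑ p, x (n, p) * v p) ⬝ᵥ (fun n => ∑ p, x (n, p) * v p) ≤ M ^ 2 * (v ⬝ᵥ v) := by
  set w : Fin N → ℝ := fun n => ∑ p, x (n, p) * v p with hw
  have hwn := real_dotProduct_self_nonneg w
  have hvn := real_dotProduct_self_nonneg v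
  rcases hwn.eq_or_lt with h0 | hwp
  · rw [← h0]; positivity
  rcases hvn.eq_or_lt with h0 | hvp
  · have : v = 0 := dotProduct_self_eq_zero.1 h0.symm
    have hw0 : w = 0 := by ext n; simp [hw, this]
    simp [hw0, this]
  have hs := Real.sqrt_pos.2 hwp
  have hr := Real.sqrt_pos.2 hvp
  have hs2 := Real.mul_self_sqrt hwn
  have hr2 := Real.mul_self_sqrt hvn
  set s := √(w ⬝ᵥ w)
  set r := √(v ⬝ᵥ v)
  have key := h (s⁻¹ • w) (r⁻¹ • v)
    (by rw [smul_dotProduct, dotProduct_smul, ← hs2]; simp only [smul_eq_mul]; field_simp)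
    (by rw [smul_dotProduct, dotProduct_smul, ← hr2]; simp only [smul_eq_mul]; field_simp)
  have e : (fun n => ∑ p, x (n, p) * (r⁻¹ • v) p) = r⁻¹ • w := by
    ext n
    simp only [hw, Pi.smul_apply, smul_eq_mul, Finset.mul_sum]
    exact Finset.sum_congr rfl fun j _ => by ring
  rw [bilinEntry_eq, e, smul_dotProduct, dotProduct_smul, ← hs2] at key
  simp only [smul_eq_mul] at key
  have e2 : s⁻¹ * (r⁻¹ * (s * s)) = s / r := by field_simp
  rw [e2, div_le_iff₀ hr] at key
  rw [← hs2, ← hr2]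
  nlinarith [mul_self_le_mul_self hs.le key]

/-- The spectral norm of a real matrix is controlled by its bilinear form on real unit vectors. -/
lemma spectralNormMat_entryMatrix_le {x : Fin N × Fin P → ℝ} {M : ℝ} (hM : 0 ≤ M)
    (h : ∀ (u : Fin N → ℝ) (v : Fin P → ℝ), u ⬝ᵥ u = 1 → v ⬝ᵥ v = 1 → bilinEntry u v x ≤ M) :
    spectralNormMat (entryMatrix x) ≤ M := by
  refine spectralNormMat_le_of_forall hM fun z => ?_
  refine abs_le_of_sq_le_sq' ?_ (by positivity) |>.2
  rw [mul_pow, EuclideanSpace.norm_sq_eq, EuclideanSpace.norm_sq_eq]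
  -- A real matrix acts separately on real and imaginary parts, so complex test vectors give nothing
  -- beyond real ones.
  have h1 := dotProduct_mulVec_self_le h fun p => (z p).re
  have h2 := dotProduct_mulVec_self_le h fun p => (z p).im
  have e1 : ∀ n, ‖(entryMatrix x).mulVec z n‖ ^ 2 =
      (∑ p, x (n, p) * (z p).re) * (∑ p, x (n, p) * (z p).re) +
        (∑ p, x (n, p) * (z p).im) * (∑ p, x (n, p) * (z p).im) := fun n => by
    rw [Complex.sq_norm, Complex.normSq_apply]
    simp [Matrix.mulVec, dotProduct, entryMatrix]
  have e2 : ∀ p, ‖z p‖ ^ 2 = (z p).re * (z p).re + (z p).im * (z p).im := fun p => by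
    rw [Complex.sq_norm, Complex.normSq_apply]
  simp only [e1, e2, Finset.sum_add_distrib, mul_add]
  exact add_le_add h1 h2

/-- The spectral norm is at most the Frobenius norm. -/
lemma spectralNormMat_entryMatrix_le_frobenius (x : Fin N × Fin P → ℝ) :
    spectralNormMat (entryMatrix x) ≤ √(x ⬝ᵥ x) :=
  spectralNormMat_entryMatrix_le (Real.sqrt_nonneg _) fun u v hu hv =>
    dotProduct_le_sqrt (by rw [tensor_dotProduct_tensor, hu, hv, one_mul]) x

/-- Pairs of real unit vectors. -/
def unitPairs (N P : ℕ) : Set ((Fin N → ℝ) × (Fin P → ℝ)) :=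
  {w | w.1 ⬝ᵥ w.1 = 1 ∧ w.2 ⬝ᵥ w.2 = 1}

lemma abs_le_one_of_dotProduct_self {ι : Type*} [Fintype ι] {u : ι → ℝ} (hu : u ⬝ᵥ u = 1) (i : ι) :
    |u i| ≤ 1 := by
  rw [← sq_le_one_iff_abs_le_one, ← hu, pow_two]
  exact Finset.single_le_sum (f := fun i => u i * u i) (fun _ _ => mul_self_nonneg _)
    (Finset.mem_univ i)

lemma isCompact_unitPairs : IsCompact (unitPairs N P) := by
  refine Metric.isCompact_of_isClosed_isBounded ?_ ?_
  · unfold unitPairs dotProduct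
    exact (isClosed_eq (by fun_prop) continuous_const).inter
      (isClosed_eq (by fun_prop) continuous_const)
  · refine isBounded_iff_forall_norm_le.2 ⟨1, fun w hw => ?_⟩
    exact norm_prod_le_iff.2 ⟨(pi_norm_le_iff_of_nonneg zero_le_one).2 fun i =>
      abs_le_one_of_dotProduct_self hw.1 i, (pi_norm_le_iff_of_nonneg zero_le_one).2 fun i =>
      abs_le_one_of_dotProduct_self hw.2 i⟩

lemma unitPairs_nonempty (hN : 0 < N) (hP : 0 < P) : (unitPairs N P).Nonempty :=
  ⟨(Pi.single ⟨0, hN⟩ 1, Pi.single ⟨0, hP⟩ 1), by simp [unitPairs]⟩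

lemma continuous_bilinEntry_left (x : Fin N × Fin P → ℝ) :
    Continuous fun w : (Fin N → ℝ) × (Fin P → ℝ) => bilinEntry w.1 w.2 x := by
  unfold bilinEntry dotProduct; fun_prop

/-- The spectral norm of a real matrix is attained on real unit vectors. -/
lemma exists_spectralNormMat_le (hN : 0 < N) (hP : 0 < P) (x : Fin N × Fin P → ℝ) :
    ∃ w ∈ unitPairs N P, spectralNormMat (entryMatrix x) ≤ bilinEntry w.1 w.2 x := by
  obtain ⟨w, hw, hmax⟩ := isCompact_unitPairs.exists_isMaxOn (unitPairs_nonempty hN hP)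
    (continuous_bilinEntry_left x).continuousOn
  refine ⟨w, hw, spectralNormMat_entryMatrix_le ?_ fun u v hu hv =>
    hmax (⟨hu, hv⟩ : (u, v) ∈ unitPairs N P)⟩
  -- Flipping the sign of one vector shows that the maximum is nonnegative.
  have h : bilinEntry (-w.1) w.2 x ≤ bilinEntry w.1 w.2 x :=
    hmax (⟨by simpa using hw.1, hw.2⟩ : (-w.1, w.2) ∈ unitPairs N P)
  rw [bilinEntry_eq, bilinEntry_eq, neg_dotProduct] at h
  rw [bilinEntry_eq]
  linarith

/-- Countably many pairs of unit vectors suffice to compute the spectral norm. -/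
lemma exists_seq_unitPairs (hN : 0 < N) (hP : 0 < P) :
    ∃ w : ℕ → (Fin N → ℝ) × (Fin P → ℝ), (∀ k, w k ∈ unitPairs N P) ∧
      ∀ (l : ℝ) (_ : 0 ≤ l) (x : Fin N × Fin P → ℝ),
        ENNReal.ofReal (Real.exp (l * spectralNormMat (entryMatrix x))) ≤
          ⨆ k, ENNReal.ofReal (Real.exp (l * bilinEntry (w k).1 (w k).2 x)) := by
  have : Nonempty (unitPairs N P) := (unitPairs_nonempty hN hP).to_subtype
  set d := TopologicalSpace.denseSeq (unitPairs N P)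
  refine ⟨fun k => d k, fun k => (d k).2, fun l hl x => ?_⟩
  obtain ⟨w, hw, hle⟩ := exists_spectralNormMat_le hN hP x
  refine (ENNReal.ofReal_le_ofReal (Real.exp_le_exp.2
    (mul_le_mul_of_nonneg_left hle hl))).trans ?_
  set S := ⨆ k, ENNReal.ofReal (Real.exp (l * bilinEntry (d k).1.1 (d k).1.2 x))
  -- The pairs obeying the bound form a closed set containing a dense sequence, hence all pairs, in
  -- particular the maximizer `w`.
  have hcl : IsClosed {p : unitPairs N P |
      ENNReal.ofReal (Real.exp (l * bilinEntry p.1.1 p.1.2 x)) ≤ S} := by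
    refine isClosed_le (ENNReal.continuous_ofReal.comp ?_) continuous_const
    have := (continuous_bilinEntry_left x).comp (continuous_subtype_val (p := (· ∈ unitPairs N P)))
    exact Real.continuous_exp.comp (continuous_const.mul this)
  have hsub : Set.range d ⊆ {p : unitPairs N P |
      ENNReal.ofReal (Real.exp (l * bilinEntry p.1.1 p.1.2 x)) ≤ S} := by
    rintro _ ⟨k, rfl⟩
    exact le_iSup (fun k => ENNReal.ofReal (Real.exp (l * bilinEntry (d k).1.1 (d k).1.2 x))) k
  exact (hcl.closure_subset_iff.2 hsub)
    (TopologicalSpace.denseRange_denseSeq (unitPairs N P) ⟨w, hw⟩)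

lemma continuous_spectralNormMat_entryMatrix :
    Continuous fun x : Fin N × Fin P → ℝ => spectralNormMat (entryMatrix x) :=
  continuous_spectralNormMat.comp continuous_entryMatrix

/-- Exponential moments of the spectral norm of a standard Gaussian matrix. -/
lemma lintegral_exp_spectralNormMat_le (hN : 0 < N) (hP : 0 < P) {l : ℝ} (hl : 0 < l) :
    ∫⁻ x, ENNReal.ofReal (Real.exp (l * spectralNormMat (entryMatrix x)))
        ∂piGaussian (Fin N × Fin P) ≤
      ENNReal.ofReal (Real.exp (l * (√N + √P) + l ^ 2 / 2)) := by
  obtain ⟨w, hw, h⟩ := exists_seq_unitPairs hN hP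
  have : Nonempty (Fin N) := ⟨⟨0, hN⟩⟩
  have : Nonempty (Fin P) := ⟨⟨0, hP⟩⟩
  refine (lintegral_mono fun x => h l hl.le x).trans ?_
  simpa using lintegral_iSup_nat_exp_bilinEntry_le (u := fun k => (w k).1) (v := fun k => (w k).2)
    (fun k => (hw k).1) (fun k => (hw k).2) hl

/-- The upper tail of the spectral norm of a standard Gaussian matrix. -/
lemma piGaussian_spectralNormMat_tail (hN : 0 < N) (hP : 0 < P) {t : ℝ} (ht : 0 ≤ t) :
    piGaussian (Fin N × Fin P) {x | √N + √P + t < spectralNormMat (entryMatrix x)} ≤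
      ENNReal.ofReal (Real.exp (-t ^ 2 / 2)) := by
  -- At `t = 0` the bound is 1 and holds trivially; the moment estimate below needs a positive
  -- exponent.
  rcases ht.eq_or_lt with rfl | ht
  · simpa using prob_le_one
  set c := Real.exp (t * (√N + √P + t)) with hc
  have h1 : ENNReal.ofReal c * piGaussian (Fin N × Fin P)
      {x | √N + √P + t < spectralNormMat (entryMatrix x)} ≤
      ENNReal.ofReal (Real.exp (t * (√N + √P) + t ^ 2 / 2)) := by
    refine le_trans ?_ (lintegral_exp_spectralNormMat_le hN hP ht)
    refine le_trans (mul_le_mul_right (measure_mono fun x hx => ?_) _)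
      (mul_meas_ge_le_lintegral ?_ _)
    · exact ENNReal.ofReal_le_ofReal (Real.exp_le_exp.2
        (mul_le_mul_of_nonneg_left (le_of_lt hx) ht.le))
    · have := (continuous_spectralNormMat_entryMatrix (N := N) (P := P)).measurable
      fun_prop
  have h2 : Real.exp (t * (√N + √P) + t ^ 2 / 2) = c * Real.exp (-t ^ 2 / 2) := by
    rw [hc, ← Real.exp_add]; ring_nf
  rw [h2, ENNReal.ofReal_mul (Real.exp_nonneg _)] at h1
  exact (ENNReal.mul_le_mul_iff_right (by simpa [hc] using Real.exp_pos _)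
    ENNReal.ofReal_ne_top).1 h1

/-- The expected spectral norm of a standard Gaussian matrix is at most `√N + √P`. -/
lemma lintegral_spectralNormMat_le (hN : 0 < N) (hP : 0 < P) :
    ∫⁻ x, ENNReal.ofReal (spectralNormMat (entryMatrix x)) ∂piGaussian (Fin N × Fin P) ≤
      ENNReal.ofReal (√N + √P) := by
  set M := √(N : ℝ) + √(P : ℝ) with hM
  have hcont := continuous_spectralNormMat_entryMatrix (N := N) (P := P)
  have hexp : ∀ l : ℝ, 0 < l → Integrable
      (fun x => Real.exp (l * spectralNormMat (entryMatrix x))) (piGaussian (Fin N × Fin P)) :=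
    fun l hl => ⟨(Real.continuous_exp.comp (continuous_const.mul hcont)).aestronglyMeasurable, by
      rw [hasFiniteIntegral_iff_ofReal (ae_of_all _ fun x => Real.exp_nonneg _)]
      exact (lintegral_exp_spectralNormMat_le hN hP hl).trans_lt ENNReal.ofReal_lt_top⟩
  have hint : Integrable (fun x => spectralNormMat (entryMatrix x))
      (piGaussian (Fin N × Fin P)) := by
    refine (hexp 1 one_pos).mono' hcont.aestronglyMeasurable (ae_of_all _ fun x => ?_)
    rw [Real.norm_of_nonneg (spectralNormMat_nonneg _), one_mul]
    linarith [Real.add_one_le_exp (spectralNormMat (entryMatrix x))]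
  rw [← ofReal_integral_eq_lintegral_ofReal hint (ae_of_all _ fun x => spectralNormMat_nonneg _)]
  refine ENNReal.ofReal_le_ofReal (le_of_forall_pos_le_add fun ε hε => ?_)
  -- From `1 + l (X - M) ≤ exp (l (X - M))` and the moment bound, `1 + l (E X - M) ≤ exp (l²/2) ≤ 1
  -- + l²`, so `E X ≤ M + l`. The cap at 1 keeps `l²/2` in the range of `Real.abs_exp_sub_one_le`.
  set l := min ε 1 with hl
  have hl0 : 0 < l := lt_min hε one_pos
  have hl1 : l ≤ 1 := min_le_right _ _
  have hE : ∫ x, Real.exp (l * spectralNormMat (entryMatrix x)) ∂piGaussian (Fin N × Fin P) ≤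
      Real.exp (l * M + l ^ 2 / 2) := by
    have := lintegral_exp_spectralNormMat_le hN hP hl0
    rwa [← ofReal_integral_eq_lintegral_ofReal (hexp l hl0)
      (ae_of_all _ fun x => Real.exp_nonneg _),
      ENNReal.ofReal_le_ofReal_iff (Real.exp_nonneg _)] at this
  have h1 : ∫ x, (1 + l * (spectralNormMat (entryMatrix x) - M)) ∂piGaussian (Fin N × Fin P) ≤
      ∫ x, Real.exp (-(l * M)) * Real.exp (l * spectralNormMat (entryMatrix x))
        ∂piGaussian (Fin N × Fin P) := by
    refine integral_mono ((integrable_const _).add ((hint.sub (integrable_const _)).const_mul _))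
      ((hexp l hl0).const_mul _) fun x => ?_
    simp only
    rw [← Real.exp_add]
    have := Real.add_one_le_exp (-(l * M) + l * spectralNormMat (entryMatrix x))
    linarith
  have h1' : ∫ x, (1 + l * (spectralNormMat (entryMatrix x) - M)) ∂piGaussian (Fin N × Fin P) =
      ∫ _, 1 ∂piGaussian (Fin N × Fin P) + ∫ x, l * (spectralNormMat (entryMatrix x) - M)
        ∂piGaussian (Fin N × Fin P) :=
    integral_add (integrable_const _) ((hint.sub (integrable_const _)).const_mul _)
  rw [h1', integral_const_mul, integral_const_mul, integral_sub hint (integrable_const _)] at h1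
  simp only [integral_const, probReal_univ, smul_eq_mul, one_mul] at h1
  have h2 : Real.exp (-(l * M)) * Real.exp (l * M + l ^ 2 / 2) ≤ 1 + l ^ 2 := by
    rw [← Real.exp_add, neg_add_cancel_left]
    have h3 : |l ^ 2 / 2| ≤ 1 := by
      rw [abs_of_nonneg (by positivity)]; nlinarith
    have h4 := (le_abs_self _).trans (Real.abs_exp_sub_one_le h3)
    rw [abs_of_nonneg (by positivity)] at h4
    linarith
  have h5 := h1.trans ((mul_le_mul_of_nonneg_left hE (Real.exp_nonneg _)).trans h2)
  have h6 : l * (∫ x, spectralNormMat (entryMatrix x) ∂piGaussian (Fin N × Fin P) - M) ≤ l * l := by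
    linarith
  have h7 := le_of_mul_le_mul_left h6 hl0
  linarith [min_le_left ε 1]

end SpectralNorm

/-! ### Mean of the norm of a Gaussian vector, in polar coordinates. -/

section ChiMean

variable {ι : Type*} [Fintype ι]

lemma integral_fun_sqrt_dotProduct [Nonempty ι] (f : ℝ → ℝ) :
    ∫ x : ι → ℝ, f √(x ⬝ᵥ x) =
      (Fintype.card ι * volume.real (Metric.ball (0 : EuclideanSpace ℝ ι) 1)) *
      ∫ y in Set.Ioi (0 : ℝ), y ^ (Fintype.card ι - 1) * f y := by
  have h := integral_fun_norm_addHaar (volume : Measure (EuclideanSpace ℝ ι)) f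
  rw [finrank_euclideanSpace] at h
  simp only [nsmul_eq_mul, smul_eq_mul] at h
  rw [mul_assoc, ← h, ← (PiLp.volume_preserving_toLp ι).integral_comp
    (MeasurableEquiv.toLp 2 (ι → ℝ)).measurableEmbedding]
  simp only [EuclideanSpace.norm_eq, Real.norm_eq_abs, sq_abs]
  simp only [dotProduct, pow_two]

lemma integral_pow_mul_exp_neg_sq_div_two (k : ℕ) :
    ∫ y in Set.Ioi (0 : ℝ), y ^ k * Real.exp (-y ^ 2 / 2) =
      (1 / 2 : ℝ) ^ (-((k : ℝ) + 1) / 2) * (1 / 2) * Real.Gamma (((k : ℝ) + 1) / 2) := by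
  rw [← integral_rpow_mul_exp_neg_mul_rpow two_pos (by have := k.cast_nonneg (α := ℝ); linarith)
    one_half_pos]
  refine setIntegral_congr_fun measurableSet_Ioi fun y _ => ?_
  simp only [Real.rpow_natCast, Real.rpow_two]
  ring_nf

/-- The mean of the Euclidean norm of a standard Gaussian vector. -/
lemma integral_sqrt_dotProduct_piGaussian [Nonempty ι] :
    ∫ x, √(x ⬝ᵥ x) ∂piGaussian ι = √2 *
      (Real.Gamma (((Fintype.card ι : ℝ) + 1) / 2) / Real.Gamma ((Fintype.card ι : ℝ) / 2)) := by
  set d := Fintype.card ι with hd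
  have hd0 : 0 < d := Fintype.card_pos
  set c := (√(2 * Real.pi))⁻¹ ^ d with hc
  set V := (d * volume.real (Metric.ball (0 : EuclideanSpace ℝ ι) 1))
  have hdens : ∀ x : ι → ℝ, piGaussianDensity x = c * Real.exp (-√(x ⬝ᵥ x) ^ 2 / 2) := fun x => by
    rw [piGaussianDensity_eq, Real.sq_sqrt (real_dotProduct_self_nonneg x)]
  have hcast : ((d - 1 : ℕ) : ℝ) = d - 1 := by rw [Nat.cast_sub hd0]; simp
  -- Total mass 1 determines the product of the ball volume and the normalizing constant, so neither
  -- has to be computed.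
  have h0 : V * (c * ((1 / 2 : ℝ) ^ (-(d : ℝ) / 2) * (1 / 2) * Real.Gamma ((d : ℝ) / 2))) = 1 := by
    have h := integral_piGaussian (fun _ : ι → ℝ => (1 : ℝ))
    simp only [integral_const, probReal_univ, smul_eq_mul, mul_one, one_mul, hdens] at h
    rw [integral_fun_sqrt_dotProduct (fun r => c * Real.exp (-r ^ 2 / 2))] at h
    simp only [mul_left_comm _ c] at h
    rw [integral_const_mul, integral_pow_mul_exp_neg_sq_div_two, hcast, sub_add_cancel] at h
    exact h.symm
  have h1 : ∫ x, √(x ⬝ᵥ x) ∂piGaussian ι = V * (c * ((1 / 2 : ℝ) ^ (-((d : ℝ) + 1) / 2) * (1 / 2) *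
      Real.Gamma (((d : ℝ) + 1) / 2))) := by
    rw [integral_piGaussian]
    simp only [hdens]
    rw [integral_fun_sqrt_dotProduct (fun r => r * (c * Real.exp (-r ^ 2 / 2)))]
    have : ∀ y : ℝ, y ^ (d - 1) * (y * (c * Real.exp (-y ^ 2 / 2))) =
        c * (y ^ d * Real.exp (-y ^ 2 / 2)) := fun y => by
      rw [← Nat.sub_add_cancel hd0, pow_succ, Nat.add_sub_cancel]; ring
    simp only [← hd, this]
    rw [integral_const_mul, integral_pow_mul_exp_neg_sq_div_two]
  have hG : Real.Gamma ((d : ℝ) / 2) ≠ 0 := (Real.Gamma_pos_of_pos (by positivity)).ne'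
  have h2 : (1 / 2 : ℝ) ^ (-((d : ℝ) + 1) / 2) = √2 * (1 / 2 : ℝ) ^ (-(d : ℝ) / 2) := by
    rw [show -((d : ℝ) + 1) / 2 = -(1 / 2) + -(d : ℝ) / 2 by ring,
      Real.rpow_add one_half_pos, Real.sqrt_eq_rpow, one_div, Real.inv_rpow two_pos.le,
      Real.rpow_neg two_pos.le, inv_inv]
  rw [h1, h2, ← mul_div_assoc √2, eq_div_iff hG]
  linear_combination (√2 * Real.Gamma (((d : ℝ) + 1) / 2)) * h0

end ChiMean

/-! ### Polynomials on the unit circle and at roots of unity. -/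

section TrigonometricPolynomial

open Polynomial

/-- Discrete Parseval inequality: a polynomial of degree less than `D` is controlled on the unit
circle by its values at the `D`-th roots of unity. -/
lemma norm_eval_sq_le_sum_roots_of_unity {D : ℕ} {g : ℂ[X]} (hg : g.natDegree < D) {ζ : ℂ}
    (hζ : IsPrimitiveRoot ζ D) {z : ℂ} (hz : ‖z‖ = 1) :
    ‖g.eval z‖ ^ 2 ≤ ∑ m ∈ Finset.range D, ‖g.eval (ζ ^ m)‖ ^ 2 := by
  have hD : D ≠ 0 := by omega
  have hζ1 : ‖ζ‖ = 1 := Complex.norm_eq_one_of_pow_eq_one hζ.pow_eq_one hD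
  have hζc : (starRingEnd ℂ) ζ = ζ⁻¹ := by
    rw [Complex.inv_def, Complex.normSq_eq_norm_sq, hζ1]; simp
  have hζ0 : ζ ≠ 0 := hζ.ne_zero hD
  have horth : ∀ a ∈ Finset.range D, ∀ b ∈ Finset.range D,
      ∑ m ∈ Finset.range D, (ζ ^ a * (ζ⁻¹) ^ b) ^ m = if a = b then (D : ℂ) else 0 := by
    intro a ha b hb
    rw [Finset.mem_range] at ha hb
    split_ifs with hab
    · subst hab
      rw [← mul_pow, mul_inv_cancel₀ hζ0]; simp
    · have hne : ζ ^ a * (ζ⁻¹) ^ b ≠ 1 := by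
        rw [inv_pow, ← div_eq_mul_inv, Ne, div_eq_one_iff_eq (pow_ne_zero _ hζ0)]
        exact fun h => hab (hζ.pow_inj ha hb h)
      have h1 := mul_neg_geom_sum (ζ ^ a * (ζ⁻¹) ^ b) D
      have h2 : (ζ ^ a * (ζ⁻¹) ^ b) ^ D = 1 := by
        rw [mul_pow, pow_right_comm, pow_right_comm ζ⁻¹, inv_pow, hζ.pow_eq_one]; simp
      rw [h2, sub_self, mul_eq_zero, sub_eq_zero] at h1
      exact h1.resolve_left (Ne.symm hne)
  have hpars : ∑ m ∈ Finset.range D, ‖g.eval (ζ ^ m)‖ ^ 2 =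
      D * ∑ a ∈ Finset.range D, ‖g.coeff a‖ ^ 2 := by
    apply Complex.ofReal_injective
    push_cast
    simp only [← Complex.mul_conj']
    have : ∀ m, g.eval (ζ ^ m) * (starRingEnd ℂ) (g.eval (ζ ^ m)) =
        ∑ a ∈ Finset.range D, ∑ b ∈ Finset.range D,
          g.coeff a * (starRingEnd ℂ) (g.coeff b) * (ζ ^ a * (ζ⁻¹) ^ b) ^ m := fun m => by
      rw [eval_eq_sum_range' hg, map_sum, Finset.sum_mul_sum]
      refine Finset.sum_congr rfl fun a _ => Finset.sum_congr rfl fun b _ => ?_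
      rw [map_mul, map_pow, map_pow, hζc]
      ring
    simp only [this]
    rw [Finset.sum_comm]
    simp only [Finset.sum_comm (s := Finset.range D) (t := Finset.range D)
      (f := fun m b => _ * _ * (_ * _) ^ m), ← Finset.mul_sum]
    rw [Finset.mul_sum]
    refine Finset.sum_congr rfl fun a ha => ?_
    rw [Finset.sum_congr rfl fun b hb => by rw [horth a ha b hb]]
    simp only [mul_ite, mul_zero, Finset.sum_ite_eq, ha, if_true]
    ring
  rw [hpars]
  -- Cauchy-Schwarz on the `D` coefficients loses a factor `D`, which is exactly the factor in
  -- Parseval's identity.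
  have h1 : ‖g.eval z‖ ≤ ∑ a ∈ Finset.range D, ‖g.coeff a‖ := by
    rw [eval_eq_sum_range' hg]
    refine (norm_sum_le _ _).trans (le_of_eq (Finset.sum_congr rfl fun a _ => ?_))
    rw [norm_mul, norm_pow, hz, one_pow, mul_one]
  refine (pow_le_pow_left₀ (norm_nonneg _) h1 2).trans ?_
  simpa using sq_sum_le_card_mul_sum_sq (s := Finset.range D) (f := fun a => ‖g.coeff a‖)

/-- A power of a trigonometric polynomial with `N` terms is controlled on the unit circle by its
values at finitely many points of the unit circle. -/
lemma exists_norm_sum_pow_le (N k : ℕ) (hN : 0 < N) : ∃ ζ : ℂ, ‖ζ‖ = 1 ∧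
    ∀ (w : Fin N → ℝ) (z : ℂ), ‖z‖ = 1 → (‖∑ n, (w n : ℂ) * z ^ (n : ℕ)‖ ^ 2) ^ k ≤
      ∑ m ∈ Finset.range (k * (N - 1) + 1), (‖∑ n, (w n : ℂ) * (ζ ^ m) ^ (n : ℕ)‖ ^ 2) ^ k := by
  -- One more than the largest possible degree of `f ^ k`, so distinct exponents stay orthogonal
  -- over the `D`-th roots of unity.
  set D := k * (N - 1) + 1 with hD
  have hζ := Complex.isPrimitiveRoot_exp D (by omega)
  refine ⟨_, Complex.norm_eq_one_of_pow_eq_one hζ.pow_eq_one (by omega), fun w z hz => ?_⟩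
  set f : ℂ[X] := ∑ n : Fin N, C (w n : ℂ) * X ^ (n : ℕ)
  have hf : ∀ y, f.eval y = ∑ n, (w n : ℂ) * y ^ (n : ℕ) := fun y => by
    simp [f, eval_finsetSum]
  have hdeg : f.natDegree ≤ N - 1 := by
    refine natDegree_sum_le_of_forall_le _ _ fun n _ => (natDegree_C_mul_X_pow_le _ _).trans ?_
    have := n.2; omega
  have hdeg2 : (f ^ k).natDegree < D :=
    lt_of_le_of_lt (natDegree_pow_le.trans (Nat.mul_le_mul_left k hdeg)) (Nat.lt_succ_self _)
  have := norm_eval_sq_le_sum_roots_of_unity hdeg2 hζ hz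
  simpa only [eval_pow, norm_pow, ← pow_mul, mul_comm k 2, hf] using this

end TrigonometricPolynomial

/-! ### Even moments of linear functionals. -/

section Moments

variable {ι : Type*} [Fintype ι]

lemma abs_dotProduct_pow_le (u x : ι → ℝ) (j : ℕ) :
    |(u ⬝ᵥ x) ^ j| ≤ ((∑ i, |u i|) ^ j * j.factorial) * Real.exp (1 * ‖x‖) := by
  rw [abs_pow, one_mul, mul_assoc]
  refine (pow_le_pow_left₀ (abs_nonneg _) (abs_dotProduct_le u x) j).trans ?_
  rw [mul_pow]
  refine mul_le_mul_of_nonneg_left ?_ (by positivity)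
  have := Real.pow_div_factorial_le_exp ‖x‖ (norm_nonneg _) j
  rwa [div_le_iff₀' (by positivity)] at this

lemma continuous_dotProduct_const (u : ι → ℝ) : Continuous fun x : ι → ℝ => u ⬝ᵥ x := by
  unfold dotProduct; fun_prop

lemma integrable_dotProduct_pow (u : ι → ℝ) (j : ℕ) :
    Integrable (fun x => (u ⬝ᵥ x) ^ j) (piGaussian ι) :=
  integrable_piGaussian_of_le_exp ((continuous_dotProduct_const u).pow j) zero_le_one
    fun x => abs_dotProduct_pow_le u x j

/-- The even moments of a linear functional of a standard Gaussian vector. -/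
lemma integral_dotProduct_pow (u : ι → ℝ) (k : ℕ) :
    ∫ x, ((u ⬝ᵥ x) ^ 2) ^ k ∂piGaussian ι =
      (u ⬝ᵥ u) ^ k * ∏ i ∈ Finset.range k, (2 * (i : ℝ) + 1) := by
  induction k with
  | zero => simp
  | succ k ih =>
    set B := ∑ i, |u i|
    have hB : 0 ≤ B := Finset.sum_nonneg fun _ _ => abs_nonneg _
    have h0 : 0 ≤ (u ⬝ᵥ u) := real_dotProduct_self_nonneg u
    have key := integral_dotProduct_mul_piGaussian (v := u) (f := fun x => (u ⬝ᵥ x) ^ (2 * k + 1))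
      (f' := fun x => (2 * k + 1) * (u ⬝ᵥ u) * (u ⬝ᵥ x) ^ (2 * k))
      (K := B ^ (2 * k + 1) * (2 * k + 1).factorial +
        (2 * k + 1) * (u ⬝ᵥ u) * (B ^ (2 * k) * (2 * k).factorial)) (c := 1) zero_le_one
      ((continuous_dotProduct_const u).pow _)
      (continuous_const.mul ((continuous_dotProduct_const u).pow _))
      (fun x => ?_) (fun x => ?_) (fun x => ?_)
    · calc _ = ∫ x, (u ⬝ᵥ x) * (u ⬝ᵥ x) ^ (2 * k + 1) ∂piGaussian ι := by
            refine integral_congr_ae (ae_of_all _ fun x => ?_)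
            simp only; ring
        _ = _ := by
            rw [key, integral_const_mul, Finset.prod_range_succ]
            simp only [pow_mul, ih]
            ring
    · refine (abs_dotProduct_pow_le u x _).trans ?_
      refine mul_le_mul_of_nonneg_right ?_ (Real.exp_nonneg _)
      have : 0 ≤ (2 * k + 1) * (u ⬝ᵥ u) * (B ^ (2 * k) * (2 * k).factorial) := by positivity
      linarith
    · rw [abs_mul, abs_of_nonneg (by positivity : 0 ≤ (2 * k + 1) * (u ⬝ᵥ u))]
      refine (mul_le_mul_of_nonneg_left (abs_dotProduct_pow_le u x _) (by positivity)).trans ?_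
      rw [← mul_assoc]
      refine mul_le_mul_of_nonneg_right ?_ (Real.exp_nonneg _)
      have : 0 ≤ B ^ (2 * k + 1) * (2 * k + 1).factorial := by positivity
      linarith
    · unfold HasLineDerivAt
      have h : HasDerivAt (fun t : ℝ => u ⬝ᵥ (x + t • u)) (u ⬝ᵥ u) 0 := by
        simp only [dotProduct_add, dotProduct_smul, smul_eq_mul]
        simpa using ((hasDerivAt_id (0 : ℝ)).mul_const (u ⬝ᵥ u)).const_add (u ⬝ᵥ x)
      refine (h.pow (2 * k + 1)).congr_deriv ?_
      simp only [zero_smul, add_zero, Nat.add_sub_cancel]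
      push_cast; ring

/-- Moments of the squared modulus of a complex linear functional of a Gaussian vector. -/
lemma integral_sq_add_sq_pow_le (u v : ι → ℝ) {s : ℝ} (hs : 0 < s) (h : u ⬝ᵥ u + v ⬝ᵥ v = s)
    (k : ℕ) :
    ∫ x, ((u ⬝ᵥ x) ^ 2 + (v ⬝ᵥ x) ^ 2) ^ k ∂piGaussian ι ≤
      s ^ k * ∏ i ∈ Finset.range k, (2 * (i : ℝ) + 1) := by
  set M := ∏ i ∈ Finset.range k, (2 * (i : ℝ) + 1)
  have hM : 0 ≤ M := Finset.prod_nonneg fun i _ => by positivity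
  -- The square is written as weight times rescaled square, in preparation for convexity of `y ↦
  -- y^k` with weights `(u ⬝ᵥ u)/s` and `(v ⬝ᵥ v)/s`. If `u ⬝ᵥ u = 0`, then `u = 0` and division by
  -- zero does no harm.
  have hpt : ∀ (u x : ι → ℝ),
      (u ⬝ᵥ u) / s * (s / (u ⬝ᵥ u) * (u ⬝ᵥ x) ^ 2) = (u ⬝ᵥ x) ^ 2 := fun u x => by
    by_cases h0 : u ⬝ᵥ u = 0
    · simp [dotProduct_self_eq_zero.1 h0]
    · field_simp
  have hi : ∀ u : ι → ℝ, Integrable (fun x => (u ⬝ᵥ u) / s * (s / (u ⬝ᵥ u) * (u ⬝ᵥ x) ^ 2) ^ k)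
      (piGaussian ι) := fun u => by
    simp only [mul_pow, ← pow_mul]
    exact ((integrable_dotProduct_pow u _).const_mul _).const_mul _
  have hbd : ∀ u : ι → ℝ, ∫ x, (u ⬝ᵥ u) / s * (s / (u ⬝ᵥ u) * (u ⬝ᵥ x) ^ 2) ^ k ∂piGaussian ι ≤
      (u ⬝ᵥ u) / s * (s ^ k * M) := fun u => by
    have h0 := real_dotProduct_self_nonneg u
    simp only [mul_pow]
    rw [integral_const_mul, integral_const_mul, integral_dotProduct_pow]
    refine mul_le_mul_of_nonneg_left ?_ (by positivity)
    rw [← mul_assoc, ← mul_pow]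
    refine mul_le_mul_of_nonneg_right (pow_le_pow_left₀ (by positivity) ?_ k) hM
    rcases h0.eq_or_lt with h1 | h1
    · rw [← h1]; simpa using hs.le
    · rw [div_mul_cancel₀ _ h1.ne']
  have hle : ∀ x : ι → ℝ, ((u ⬝ᵥ x) ^ 2 + (v ⬝ᵥ x) ^ 2) ^ k ≤
      (u ⬝ᵥ u) / s * (s / (u ⬝ᵥ u) * (u ⬝ᵥ x) ^ 2) ^ k +
        (v ⬝ᵥ v) / s * (s / (v ⬝ᵥ v) * (v ⬝ᵥ x) ^ 2) ^ k := fun x => by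
    have hu := real_dotProduct_self_nonneg u
    have hv := real_dotProduct_self_nonneg v
    have hx : s / (u ⬝ᵥ u) * (u ⬝ᵥ x) ^ 2 ∈ Set.Ici (0 : ℝ) := Set.mem_Ici.2 (by positivity)
    have hy : s / (v ⬝ᵥ v) * (v ⬝ᵥ x) ^ 2 ∈ Set.Ici (0 : ℝ) := Set.mem_Ici.2 (by positivity)
    have := (convexOn_pow k).2 hx hy (div_nonneg hu hs.le) (div_nonneg hv hs.le)
      (by rw [← add_div, h, div_self hs.ne'])
    simpa only [smul_eq_mul, hpt] using this
  calc _ ≤ ∫ x, ((u ⬝ᵥ u) / s * (s / (u ⬝ᵥ u) * (u ⬝ᵥ x) ^ 2) ^ k +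
        (v ⬝ᵥ v) / s * (s / (v ⬝ᵥ v) * (v ⬝ᵥ x) ^ 2) ^ k) ∂piGaussian ι :=
        integral_mono_of_nonneg (ae_of_all _ fun x => by positivity) ((hi u).add (hi v))
          (ae_of_all _ hle)
    _ ≤ (u ⬝ᵥ u) / s * (s ^ k * M) + (v ⬝ᵥ v) / s * (s ^ k * M) := by
        rw [integral_add (hi u) (hi v)]
        exact add_le_add (hbd u) (hbd v)
    _ = _ := by rw [← add_mul, ← add_div, h, div_self hs.ne', one_mul]

lemma integrable_sq_add_sq_pow (u v : ι → ℝ) (k : ℕ) :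
    Integrable (fun x => ((u ⬝ᵥ x) ^ 2 + (v ⬝ᵥ x) ^ 2) ^ k) (piGaussian ι) := by
  have hc := continuous_dotProduct_const u
  have hd := continuous_dotProduct_const v
  refine (((integrable_dotProduct_pow u (2 * k)).add
    (integrable_dotProduct_pow v (2 * k))).const_mul (2 ^ (k - 1))).mono'
    (by fun_prop) (ae_of_all _ fun x => ?_)
  rw [Real.norm_of_nonneg (by positivity), Pi.add_apply, pow_mul, pow_mul]
  exact add_pow_le (sq_nonneg _) (sq_nonneg _) k

end Moments

/-! ### Choice of the moment exponent. -/

section Numeric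

lemma two_mul_pow_self_le (k : ℕ) (hk : 0 < k) : 2 * (k : ℝ) ^ k ≤ ((k : ℝ) + 1) ^ k := by
  have hk' : (0 : ℝ) < k := by exact_mod_cast hk
  have h := one_add_mul_le_pow (a := (1 / k : ℝ)) (by linarith [one_div_pos.2 hk']) k
  rw [mul_one_div_cancel hk'.ne'] at h
  have h2 : ((k : ℝ) + 1) ^ k = k ^ k * (1 + 1 / k) ^ k := by
    rw [← mul_pow]; congr 1; field_simp
  rw [h2]
  nlinarith [pow_pos hk' k]

/-- For `N ≤ exp (k + 1)` the left side dominates `D (2k-1)!!`. From `k` to `k + 1` it grows by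
`(k+1)/k · e(2k+1) ≤ 8(k+1)`, whereas the right side grows by `4(k+1)(1 + 1/k)^k ≥ 8(k+1)`. At `k =
4` the claim is `420 e⁵ ≤ 16⁴`. -/
lemma mul_exp_mul_prod_le {k : ℕ} (hk : 4 ≤ k) :
    k * Real.exp (k + 1) * ∏ i ∈ Finset.range k, (2 * (i : ℝ) + 1) ≤ (4 * (k : ℝ)) ^ k := by
  have he := Real.exp_one_lt_d9
  induction k, hk using Nat.le_induction with
  | base =>
    have h5 : Real.exp (((4 : ℕ) : ℝ) + 1) = Real.exp 1 ^ 5 := by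
      rw [← Real.exp_nat_mul]; norm_num
    have : Real.exp 1 ^ 5 ≤ 2.7182818286 ^ 5 :=
      pow_le_pow_left₀ (Real.exp_nonneg _) he.le 5
    rw [h5]
    norm_num [Finset.prod_range_succ] at this ⊢
    linarith
  | succ k hk ih =>
    have hk' : (4 : ℝ) ≤ k := by exact_mod_cast hk
    set A := k * Real.exp (k + 1) * ∏ i ∈ Finset.range k, (2 * (i : ℝ) + 1) with hA
    have hA0 : 0 ≤ A := mul_nonneg (by positivity) (Finset.prod_nonneg fun i _ => by positivity)
    have h1 : k * ((k + 1 : ℕ) * Real.exp ((k + 1 : ℕ) + 1) *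
        ∏ i ∈ Finset.range (k + 1), (2 * (i : ℝ) + 1)) =
        (k + 1) * (Real.exp 1 * (2 * k + 1)) * A := by
      rw [Finset.prod_range_succ, hA]
      push_cast
      rw [Real.exp_add ((k : ℝ) + 1) 1]
      ring
    have h2 : Real.exp 1 * (2 * k + 1) ≤ 8 * k := by nlinarith
    have h3 : (k : ℝ) * ((k + 1 : ℕ) * Real.exp ((k + 1 : ℕ) + 1) *
        ∏ i ∈ Finset.range (k + 1), (2 * (i : ℝ) + 1)) ≤ k * (8 * (k + 1) * A) := by
      rw [h1]
      calc _ ≤ ((k : ℝ) + 1) * (8 * k) * A := by gcongr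
        _ = _ := by ring
    refine (le_of_mul_le_mul_left h3 (by linarith)).trans ?_
    calc 8 * ((k : ℝ) + 1) * A ≤ 8 * (k + 1) * (4 * k) ^ k := by gcongr
      _ = 4 * (k + 1) * 4 ^ k * (2 * k ^ k) := by rw [mul_pow]; ring
      _ ≤ 4 * (k + 1) * 4 ^ k * (k + 1) ^ k := by
          gcongr; exact two_mul_pow_self_le k (by omega)
      _ = _ := by push_cast; rw [pow_succ, mul_pow]; ring

lemma four_mul_log_pow_ge {N : ℕ} {c : ℝ} (hc : 0 ≤ c) (hL : c ≤ Real.log N)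
    (hN : 105 * (4 * (N - 1 : ℝ) + 1) ≤ (4 * c) ^ 4) :
    105 * (4 * (N - 1 : ℝ) + 1) ≤ (4 * Real.log N) ^ 4 :=
  hN.trans (pow_le_pow_left₀ (by positivity) (by linarith) 4)

lemma mul_log_two_le_log {N a : ℕ} (h : 2 ^ a ≤ N) : a * 0.6931471803 ≤ Real.log N := by
  have h1 : Real.log ((2 : ℝ) ^ a) ≤ Real.log N :=
    Real.log_le_log (by positivity) (by exact_mod_cast h)
  rw [Real.log_pow] at h1
  have := Real.log_two_gt_d9
  have ha : (0 : ℝ) ≤ a := a.cast_nonneg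
  nlinarith

lemma exists_moment_exponent {N : ℕ} (hN : 9 ≤ N) : ∃ k : ℕ, 0 < k ∧
    ((k * (N - 1) + 1 : ℕ) : ℝ) * ∏ i ∈ Finset.range k, (2 * (i : ℝ) + 1) ≤
      (4 * Real.log N) ^ k := by
  have hcast : ((N - 1 : ℕ) : ℝ) = N - 1 := by rw [Nat.cast_sub (by omega)]; simp
  -- Up to 338 the exponent `k = 4` suffices. The range is cut so that on each piece a bound `2^a ≤
  -- N` (or `2^7 ≤ N^2`) gives a strong enough lower bound for `log N`.
  rcases le_or_gt N 338 with h338 | h338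
  · refine ⟨4, by norm_num, ?_⟩
    have hprod : ∏ i ∈ Finset.range 4, (2 * (i : ℝ) + 1) = 105 := by
      norm_num [Finset.prod_range_succ]
    rw [hprod, mul_comm]
    push_cast
    rw [hcast]
    have hcase : ∀ (a M : ℕ), 2 ^ a ≤ N → N ≤ M →
        105 * (4 * (M - 1 : ℝ) + 1) ≤ (4 * (a * 0.6931471803)) ^ 4 →
        105 * (4 * (N - 1 : ℝ) + 1) ≤ (4 * Real.log N) ^ 4 := fun a M h1 h2 h3 => by
      have : (N : ℝ) ≤ M := by exact_mod_cast h2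
      exact four_mul_log_pow_ge (by positivity) (mul_log_two_le_log h1) (by linarith)
    rcases le_or_gt N 11 with h | h
    · exact hcase 3 11 (by omega) h (by norm_num)
    rcases le_or_gt N 20 with h' | h'
    · have h1 : ((7 : ℕ) : ℝ) * 0.6931471803 ≤ Real.log (N ^ 2 : ℕ) :=
        mul_log_two_le_log (by nlinarith)
      rw [Nat.cast_pow, Real.log_pow] at h1
      have h2 : (N : ℝ) ≤ 20 := by exact_mod_cast h'
      refine four_mul_log_pow_ge (c := 7 / 2 * 0.6931471803) (by norm_num) ?_ ?_
      · push_cast at h1; linarith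
      · refine le_trans (b := 105 * (4 * (20 - 1 : ℝ) + 1)) (by linarith) (by norm_num)
    rcases le_or_gt N 36 with h | h
    · exact hcase 4 36 (by omega) h (by norm_num)
    rcases le_or_gt N 88 with h | h
    · exact hcase 5 88 (by omega) h (by norm_num)
    rcases le_or_gt N 183 with h | h
    · exact hcase 6 183 (by omega) h (by norm_num)
    · exact hcase 7 338 (by omega) h338 (by norm_num)
  · set L := Real.log N with hL
    have hL4 : 4 ≤ L := by
      have := mul_log_two_le_log (N := N) (a := 8) (by omega)
      norm_num at this
      linarith
    have hL0 : 0 ≤ L := by linarith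
    -- Rounding down gives `k ≤ log N` on the right and `N ≤ exp (k + 1)` for the number of nodes.
    set k := ⌊L⌋₊ with hk
    have hk4 : 4 ≤ k := Nat.le_floor (by exact_mod_cast hL4)
    have hkL : (k : ℝ) ≤ L := Nat.floor_le hL0
    have hNk : (N : ℝ) ≤ Real.exp (k + 1) := by
      rw [← Real.log_le_iff_le_exp (by positivity)]
      exact (Nat.lt_floor_add_one L).le
    have hk0 : (1 : ℝ) ≤ k := by exact_mod_cast (by omega : 1 ≤ k)
    have hM : 0 ≤ ∏ i ∈ Finset.range k, (2 * (i : ℝ) + 1) :=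
      Finset.prod_nonneg fun i _ => by positivity
    refine ⟨k, by omega, ?_⟩
    calc _ ≤ (k * Real.exp (k + 1)) * ∏ i ∈ Finset.range k, (2 * (i : ℝ) + 1) := by
          refine mul_le_mul_of_nonneg_right ?_ hM
          push_cast
          rw [hcast]
          nlinarith
      _ ≤ (4 * (k : ℝ)) ^ k := mul_exp_mul_prod_le hk4
      _ ≤ _ := by gcongr

/-- The trivial bound `N²` for the mean square is at most `4N log N` precisely in this range: the
inequality already fails at `N = 9`. Each case uses `2^a ≤ N^b`, which gives `log N ≥ (a/b) log 2`.
-/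
lemma le_four_mul_log {N : ℕ} (h2 : 2 ≤ N) (h8 : N ≤ 8) : (N : ℝ) ≤ 4 * Real.log N := by
  have h : ∀ (a b M : ℕ), 0 < b → 2 ^ a ≤ N ^ b → N ≤ M → (M : ℝ) * b ≤ 4 * (a * 0.6931471803) →
      (N : ℝ) ≤ 4 * Real.log N := fun a b M hb h1 hM h3 => by
    have h4 := mul_log_two_le_log h1
    rw [Nat.cast_pow, Real.log_pow] at h4
    have hb' : (0 : ℝ) < b := by exact_mod_cast hb
    have hM' : (N : ℝ) ≤ M := by exact_mod_cast hM
    refine le_of_mul_le_mul_right ?_ hb'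
    nlinarith
  interval_cases N
  · exact h 1 1 2 (by norm_num) (by norm_num) (by norm_num) (by norm_num)
  · exact h 3 2 3 (by norm_num) (by norm_num) (by norm_num) (by norm_num)
  · exact h 2 1 4 (by norm_num) (by norm_num) (by norm_num) (by norm_num)
  · exact h 2 1 5 (by norm_num) (by norm_num) (by norm_num) (by norm_num)
  · exact h 5 2 6 (by norm_num) (by norm_num) (by norm_num) (by norm_num)
  · exact h 11 4 7 (by norm_num) (by norm_num) (by norm_num) (by norm_num)
  · exact h 3 1 8 (by norm_num) (by norm_num) (by norm_num) (by norm_num)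

end Numeric

/-! ### Supremum of the random polynomial of one column. -/

section ColumnBound

variable {N P : ℕ}

/-- The coefficients `Re zⁿ` (for `f = Complex.re`) placed in column `p`. -/
def columnCoeff (f : ℂ → ℝ) (z : ℂ) (p : Fin P) : Fin N × Fin P → ℝ :=
  fun i => if i.2 = p then f (z ^ (i.1 : ℕ)) else 0

lemma columnCoeff_dotProduct (f : ℂ → ℝ) (z : ℂ) (p : Fin P) (x : Fin N × Fin P → ℝ) :
    columnCoeff f z p ⬝ᵥ x = ∑ n : Fin N, f (z ^ (n : ℕ)) * x (n, p) := by
  simp [columnCoeff, dotProduct, Fintype.sum_prod_type]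

lemma norm_column_sq (z : ℂ) (p : Fin P) (x : Fin N × Fin P → ℝ) :
    ‖∑ n : Fin N, (x (n, p) : ℂ) * z ^ (n : ℕ)‖ ^ 2 =
      (columnCoeff Complex.re z p ⬝ᵥ x) ^ 2 + (columnCoeff Complex.im z p ⬝ᵥ x) ^ 2 := by
  rw [Complex.sq_norm, Complex.normSq_apply, columnCoeff_dotProduct, columnCoeff_dotProduct,
    Complex.re_sum, Complex.im_sum]
  simp only [Complex.re_ofReal_mul, Complex.im_ofReal_mul, mul_comm (x _), pow_two]

lemma columnCoeff_dotProduct_self {z : ℂ} (hz : ‖z‖ = 1) (p : Fin P) :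
    columnCoeff (N := N) Complex.re z p ⬝ᵥ columnCoeff Complex.re z p +
      columnCoeff (N := N) Complex.im z p ⬝ᵥ columnCoeff Complex.im z p = N := by
  simp only [columnCoeff_dotProduct, columnCoeff, if_true, ← Finset.sum_add_distrib,
    ← Complex.normSq_apply, ← Complex.sq_norm, norm_pow, hz, one_pow]
  simp

/-- The squared supremum over the unit circle of the polynomial with coefficients in a column of a
standard Gaussian matrix has an integrable majorant of mean at most `4 N log N`. -/
lemma exists_column_majorant (hN : 2 ≤ N) (p : Fin P) :
    ∃ T : (Fin N × Fin P → ℝ) → ℝ,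
      (∀ x z, ‖z‖ = 1 → ‖∑ n : Fin N, (x (n, p) : ℂ) * z ^ (n : ℕ)‖ ^ 2 ≤ T x) ∧
      Integrable T (piGaussian (Fin N × Fin P)) ∧
      ∫ x, T x ∂piGaussian (Fin N × Fin P) ≤ 4 * N * Real.log N := by
  have hN0 : (0 : ℝ) < N := by exact_mod_cast (by omega : 0 < N)
  rcases le_or_gt N 8 with h8 | h9
  -- Cauchy-Schwarz over the coefficients; the mean of this majorant is `N²`.
  · refine ⟨fun x => N * ∑ n : Fin N, ((Pi.single (n, p) 1 : Fin N × Fin P → ℝ) ⬝ᵥ x) ^ 2,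
      fun x z hz => ?_, ?_, ?_⟩
    · have h1 : ‖∑ n : Fin N, (x (n, p) : ℂ) * z ^ (n : ℕ)‖ ≤ ∑ n : Fin N, |x (n, p)| := by
        refine (norm_sum_le _ _).trans (le_of_eq (Finset.sum_congr rfl fun n _ => ?_))
        rw [norm_mul, norm_pow, hz, one_pow, mul_one, Complex.norm_real, Real.norm_eq_abs]
      refine (pow_le_pow_left₀ (norm_nonneg _) h1 2).trans ?_
      simpa using sq_sum_le_card_mul_sum_sq (s := Finset.univ) (f := fun n : Fin N => |x (n, p)|)
    · exact (integrable_finsetSum _ fun n _ => integrable_dotProduct_pow _ 2).const_mul _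
    · rw [integral_const_mul, integral_finsetSum _ fun n _ => integrable_dotProduct_pow _ 2]
      have h1 : ∀ n : Fin N, ∫ x, ((Pi.single (n, p) 1 : Fin N × Fin P → ℝ) ⬝ᵥ x) ^ 2
          ∂piGaussian (Fin N × Fin P) = 1 := fun n => by
        have := integral_dotProduct_pow (Pi.single (n, p) 1 : Fin N × Fin P → ℝ) 1
        simpa using this
      simp only [h1, Finset.sum_const, Finset.card_univ, Fintype.card_fin, nsmul_eq_mul, mul_one]
      nlinarith [le_four_mul_log hN h8]
  · obtain ⟨k, hk, hkN⟩ := exists_moment_exponent (N := N) (by omega)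
    obtain ⟨ζ, hζ, hle⟩ := exists_norm_sum_pow_le N k (by omega)
    set D := k * (N - 1) + 1
    have hlog : 0 < Real.log N := Real.log_pos (by exact_mod_cast (by omega : 1 < N))
    have hk' : (0 : ℝ) < k := by exact_mod_cast hk
    set c := 4 * N * Real.log N with hc
    have hc0 : 0 < c := by positivity
    clear_value c
    set S : (Fin N × Fin P → ℝ) → ℝ := fun x => ∑ m ∈ Finset.range D,
      ((columnCoeff Complex.re (ζ ^ m) p ⬝ᵥ x) ^ 2 +
        (columnCoeff Complex.im (ζ ^ m) p ⬝ᵥ x) ^ 2) ^ k with hS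
    have hSi : Integrable S (piGaussian (Fin N × Fin P)) :=
      integrable_finsetSum _ fun m _ => integrable_sq_add_sq_pow _ _ k
    have hSE : ∫ x, S x ∂piGaussian (Fin N × Fin P) ≤ c ^ k := by
      rw [hS, integral_finsetSum _ fun m _ => integrable_sq_add_sq_pow _ _ k]
      have h1 := Finset.sum_le_sum fun m (_ : m ∈ Finset.range D) => integral_sq_add_sq_pow_le _ _
        hN0 (columnCoeff_dotProduct_self (N := N) (z := ζ ^ m) (by simp [hζ]) p) k
      refine h1.trans ?_
      rw [Finset.sum_const, Finset.card_range, nsmul_eq_mul]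
      calc _ = (N : ℝ) ^ k * ((D : ℝ) * ∏ i ∈ Finset.range k, (2 * (i : ℝ) + 1)) := by ring
        _ ≤ (N : ℝ) ^ k * (4 * Real.log N) ^ k := by gcongr
        _ = c ^ k := by rw [← mul_pow, hc]; ring_nf
    -- Bernoulli's inequality `(y/c)^k ≥ 1 + k (y/c - 1)` bounds `y` by an affine function of `y^k`.
    -- This replaces a `k`-th root and Jensen's inequality: the mean of the majorant is at most `c`
    -- as soon as `E S ≤ c^k`.
    refine ⟨fun x => c + c / k * ((c ^ k)⁻¹ * S x - 1), fun x z hz => ?_, ?_, ?_⟩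
    · have h1 := hle (fun n => x (n, p)) z hz
      simp only [norm_column_sq] at h1
      rw [norm_column_sq]
      set y := (columnCoeff Complex.re z p ⬝ᵥ x) ^ 2 + (columnCoeff Complex.im z p ⬝ᵥ x) ^ 2
      have hy : 0 ≤ y := by positivity
      have h2 := one_add_mul_le_pow (a := y / c - 1)
        (by linarith [div_nonneg hy hc0.le]) k
      rw [add_sub_cancel, div_pow] at h2
      have h3 : y ^ k / c ^ k ≤ (c ^ k)⁻¹ * S x := by
        rw [div_eq_inv_mul]
        exact mul_le_mul_of_nonneg_left h1 (by positivity)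
      have h4 : c / k * (k * (y / c - 1)) = y - c := by field_simp
      have h5 : c / k * (k * (y / c - 1)) ≤ c / k * ((c ^ k)⁻¹ * S x - 1) :=
        mul_le_mul_of_nonneg_left (by linarith) (by positivity)
      linarith
    · exact (integrable_const _).add (((hSi.const_mul _).sub (integrable_const _)).const_mul _)
    · have h1 : ∫ x, (c + c / k * ((c ^ k)⁻¹ * S x - 1)) ∂piGaussian (Fin N × Fin P) =
          c + c / k * ((c ^ k)⁻¹ * ∫ x, S x ∂piGaussian (Fin N × Fin P) - 1) := by
        have hi : Integrable (fun x => (c ^ k)⁻¹ * S x - 1) (piGaussian (Fin N × Fin P)) :=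
          (hSi.const_mul _).sub (integrable_const _)
        rw [integral_add (integrable_const _) (hi.const_mul _), integral_const_mul,
          integral_sub (hSi.const_mul _) (integrable_const _), integral_const_mul]
        simp
      rw [h1]
      have h2 : (c ^ k)⁻¹ * ∫ x, S x ∂piGaussian (Fin N × Fin P) ≤ 1 := by
        rw [inv_mul_le_iff₀ (by positivity), mul_one]
        exact hSE
      have h3 : c / k * ((c ^ k)⁻¹ * ∫ x, S x ∂piGaussian (Fin N × Fin P) - 1) ≤ 0 :=
        mul_nonpos_of_nonneg_of_nonpos (by positivity) (by linarith)
      linarith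

end ColumnBound

/-! ### Deterministic bound and measurability of the dual norm. -/

section DualNorm

variable {N P : ℕ}

lemma steeringVector_eq_pow (ξ θ : ℝ) (n : Fin N) : steeringVector N ξ θ n =
    Complex.exp ((ξ * Real.sin θ : ℝ) * Complex.I) ^ (n : ℕ) := by
  rw [steeringVector, ← Complex.exp_nat_mul]
  push_cast
  ring_nf

lemma norm_steeringVector (ξ θ : ℝ) (n : Fin N) : ‖steeringVector N ξ θ n‖ = 1 := by
  rw [steeringVector_eq_pow, norm_pow, Complex.norm_exp_ofReal_mul_I, one_pow]

lemma matrixInner_gpAtom (ξ : ℝ) (e : EuclideanSpace ℂ (Fin N)) (θ : ℝ)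
    (d : EuclideanSpace ℂ (Fin P)) (U : Matrix (Fin N) (Fin P) ℂ) :
    matrixInner (gpAtom ξ e θ d) U =
      ((U.conjTranspose.mulVec (fun n => e n * steeringVector N ξ θ n) +
        U.conjTranspose.mulVec (steeringVector N ξ θ)) ⬝ᵥ (fun p => d p)).re := by
  have h : (Matrix.diagonal (fun n => e n) + 1).mulVec (steeringVector N ξ θ) =
      (fun n => e n * steeringVector N ξ θ n) + steeringVector N ξ θ := by
    rw [Matrix.add_mulVec, Matrix.one_mulVec]
    congr 1
    ext n
    rw [Matrix.mulVec_diagonal]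
  rw [matrixInner, gpAtom, Matrix.mul_vecMulVec, Matrix.trace_vecMulVec, h, Matrix.mulVec_add]

lemma re_dotProduct_le {ι : Type*} [Fintype ι] (a b : ι → ℂ) :
    (a ⬝ᵥ b).re ≤ ‖WithLp.toLp 2 a‖ * ‖WithLp.toLp 2 b‖ := by
  refine (Complex.re_le_norm _).trans ((norm_sum_le _ _).trans ?_)
  simp only [norm_mul, EuclideanSpace.norm_eq]
  exact Real.sum_mul_le_sqrt_mul_sqrt _ _ _

/-- Cauchy-Schwarz against `d`, then the spectral norm acts on `e ∘ a(θ)`, whose norm is `‖e‖`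
because the steering entries are unimodular. -/
lemma matrixInner_gpAtom_le {ξ Ce θ Q : ℝ} {e : EuclideanSpace ℂ (Fin N)} (he : ‖e‖ ≤ Ce)
    {d : EuclideanSpace ℂ (Fin P)} (hd : ‖d‖ ≤ 1) {U : Matrix (Fin N) (Fin P) ℂ}
    (hQ : ‖WithLp.toLp 2 (U.conjTranspose.mulVec (steeringVector N ξ θ))‖ ≤ Q) :
    matrixInner (gpAtom ξ e θ d) U ≤ spectralNormMat U * Ce + Q := by
  rw [matrixInner_gpAtom]
  refine (re_dotProduct_le _ _).trans ((mul_le_of_le_one_right (norm_nonneg _) hd).trans ?_)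
  rw [WithLp.toLp_add]
  refine (norm_add_le _ _).trans (add_le_add ?_ hQ)
  refine (norm_mulVec_le_spectralNormMat _ _).trans ?_
  rw [spectralNormMat_conjTranspose]
  refine mul_le_mul_of_nonneg_left (le_of_eq_of_le ?_ he) (spectralNormMat_nonneg U)
  simp only [EuclideanSpace.norm_eq, norm_mul, norm_steeringVector, mul_one]

lemma matrixInner_sum_smul {K : ℕ} (b : Fin K → ℝ) (A : Fin K → Matrix (Fin N) (Fin P) ℂ)
    (U : Matrix (Fin N) (Fin P) ℂ) :
    matrixInner (∑ k, (b k : ℂ) • A k) U = ∑ k, b k * matrixInner (A k) U := by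
  simp only [matrixInner, Matrix.mul_sum, Matrix.trace_sum, Complex.re_sum, Matrix.mul_smul,
    Matrix.trace_smul, smul_eq_mul, Complex.re_ofReal_mul]

/-- The dual norm is at most `‖U‖₂ Ce + sup_θ ‖Uᴴ a(θ)‖`. -/
lemma gpDualNorm_le {ξ Ce Q : ℝ} (hCe : 0 ≤ Ce) {U : Matrix (Fin N) (Fin P) ℂ}
    (hQ : ∀ θ, ‖WithLp.toLp 2 (U.conjTranspose.mulVec (steeringVector N ξ θ))‖ ≤ Q) :
    gpDualNorm ξ Ce U ≤ ENNReal.ofReal (spectralNormMat U * Ce + Q) := by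
  have hQ0 : 0 ≤ Q := (norm_nonneg _).trans (hQ 0)
  set B := spectralNormMat U * Ce + Q
  have hB : 0 ≤ B := add_nonneg (mul_nonneg (spectralNormMat_nonneg U) hCe) hQ0
  refine iSup₂_le fun X hX => ?_
  unfold gpAtomicNorm at hX
  have key : ∀ s ∈ {s : ℝ≥0∞ | ∃ (K : ℕ) (e : EuclideanSpace ℂ (Fin N)) (b : Fin K → ℝ≥0)
    (θ : Fin K → ℝ) (d : Fin K → EuclideanSpace ℂ (Fin P)),
      ‖e‖ ≤ Ce ∧ (∀ k, θ k ∈ Set.Ico 0 (2 * Real.pi)) ∧ (∀ k, ‖d k‖ ≤ 1) ∧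
      X = ∑ k, ((b k : ℝ) : ℂ) • gpAtom ξ e (θ k) (d k) ∧
      s = ∑ k, (b k : ℝ≥0∞)}, ENNReal.ofReal (matrixInner X U) ≤ s * ENNReal.ofReal B := by
    rintro s ⟨K, e, b, θ, d, he, -, hd, rfl, rfl⟩
    have hb : ∀ k, 0 ≤ (b k : ℝ) := fun k => NNReal.coe_nonneg _
    have h1 : (∑ k, (b k : ℝ≥0∞)) = ENNReal.ofReal (∑ k, (b k : ℝ)) := by
      rw [ENNReal.ofReal_sum_of_nonneg fun k _ => hb k]
      simp
    rw [h1, ← ENNReal.ofReal_mul (Finset.sum_nonneg fun k _ => hb k), matrixInner_sum_smul,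
      Finset.sum_mul]
    exact ENNReal.ofReal_le_ofReal (Finset.sum_le_sum fun k _ =>
      mul_le_mul_of_nonneg_left (matrixInner_gpAtom_le he (hd k) (hQ _)) (b k).2)
  -- The infimum need not be attained, so `key` is divided by `B` and passed to the infimum. When
  -- `B` is zero any single decomposition suffices; one exists because the infimum is below 2.
  rcases eq_or_ne (ENNReal.ofReal B) 0 with h0 | h0
  · obtain ⟨s, hs, -⟩ := sInf_lt_iff.1 (hX.trans_lt ENNReal.one_lt_two)
    have := key s hs
    rwa [h0, mul_zero, ← h0] at this
  · have h1 : ENNReal.ofReal (matrixInner X U) / ENNReal.ofReal B ≤ 1 :=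
      le_trans (le_sInf fun s hs => ENNReal.div_le_of_le_mul (key s hs)) hX
    rwa [ENNReal.div_le_iff h0 ENNReal.ofReal_ne_top, one_mul] at h1

lemma continuous_matrixInner (X : Matrix (Fin N) (Fin P) ℂ) : Continuous (matrixInner X) := by
  unfold matrixInner
  exact Complex.continuous_re.comp
    ((continuous_id.matrix_conjTranspose.matrix_mul continuous_const).matrix_trace)

/-- The supremum is over uncountably many `X`, but a supremum of continuous functions is lower
semicontinuous. -/
lemma measurable_gpDualNorm_entryMatrix (ξ Ce : ℝ) :
    Measurable fun x : Fin N × Fin P → ℝ => gpDualNorm ξ Ce (entryMatrix x) := by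
  refine LowerSemicontinuous.measurable ?_
  unfold gpDualNorm
  exact lowerSemicontinuous_iSup fun X => lowerSemicontinuous_iSup fun _ =>
    (ENNReal.continuous_ofReal.comp
      ((continuous_matrixInner X).comp continuous_entryMatrix)).lowerSemicontinuous

lemma conjTranspose_entryMatrix_mulVec (x : Fin N × Fin P → ℝ) (ξ θ : ℝ) (p : Fin P) :
    (entryMatrix x).conjTranspose.mulVec (steeringVector N ξ θ) p =
      ∑ n : Fin N, (x (n, p) : ℂ) * Complex.exp ((ξ * Real.sin θ : ℝ) * Complex.I) ^ (n : ℕ) := by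
  simp only [Matrix.mulVec, dotProduct, Matrix.conjTranspose_apply, entryMatrix,
    steeringVector_eq_pow]
  simp

lemma norm_conjTranspose_entryMatrix_mulVec_le {x : Fin N × Fin P → ℝ} {T : Fin P → ℝ}
    (hT : ∀ p z, ‖z‖ = 1 → ‖∑ n : Fin N, (x (n, p) : ℂ) * z ^ (n : ℕ)‖ ^ 2 ≤ T p) (ξ θ : ℝ) :
    ‖WithLp.toLp 2 ((entryMatrix x).conjTranspose.mulVec (steeringVector N ξ θ))‖ ≤
      √(∑ p, T p) := by
  rw [EuclideanSpace.norm_eq]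
  refine Real.sqrt_le_sqrt (Finset.sum_le_sum fun p _ => ?_)
  simp only [conjTranspose_entryMatrix_mulVec]
  exact hT p _ (Complex.norm_exp_ofReal_mul_I _)

end DualNorm

/-! ### Expected dual norm of a Gaussian matrix. -/

section GaussianMatrix

variable {N P : ℕ}

/-- Jensen's inequality for the square root, by way of its tangent line at `B`: `√y ≤ (y/√B +
√B)/2`. -/
lemma lintegral_sqrt_le {α : Type*} [MeasurableSpace α] {μ : Measure α} [IsProbabilityMeasure μ]
    {Y : α → ℝ} (hY : Integrable Y μ) (hY0 : ∀ x, 0 ≤ Y x) {B : ℝ} (hB : 0 < B)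
    (hE : ∫ x, Y x ∂μ ≤ B) : ∫⁻ x, ENNReal.ofReal √(Y x) ∂μ ≤ ENNReal.ofReal √B := by
  have hs := Real.sqrt_pos.2 hB
  have hss := Real.mul_self_sqrt hB.le
  have h1 : ∀ x, √(Y x) ≤ (Y x / √B + √B) / 2 := fun x => by
    have h := Real.mul_self_sqrt (hY0 x)
    have : Y x / √B + √B - 2 * √(Y x) = (√(Y x) - √B) ^ 2 / √B := by
      field_simp
      linear_combination -h
    have : 0 ≤ (√(Y x) - √B) ^ 2 / √B := by positivity
    linarith
  have hint : Integrable (fun x => (Y x / √B + √B) / 2) μ :=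
    ((hY.div_const _).add (integrable_const _)).div_const _
  refine (lintegral_mono fun x => ENNReal.ofReal_le_ofReal (h1 x)).trans ?_
  rw [← ofReal_integral_eq_lintegral_ofReal hint (ae_of_all _ fun x => by
    have := hY0 x; simp only [Pi.zero_apply]; positivity)]
  refine ENNReal.ofReal_le_ofReal ?_
  rw [integral_div, integral_add (hY.div_const _) (integrable_const _), integral_div]
  simp only [integral_const, probReal_univ, smul_eq_mul, one_mul]
  have : (∫ x, Y x ∂μ) / √B ≤ √B := by rw [div_le_iff₀ hs, hss]; exact hE
  linarith

/-- The expected spectral norm of a standard Gaussian matrix is at most the expected Frobenius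
norm. -/
lemma lintegral_spectralNormMat_le_gamma (hN : 0 < N) (hP : 0 < P) :
    ∫⁻ x, ENNReal.ofReal (spectralNormMat (entryMatrix x)) ∂piGaussian (Fin N × Fin P) ≤
      ENNReal.ofReal (√2 * (Real.Gamma (((N : ℝ) * P + 1) / 2) /
        Real.Gamma ((N : ℝ) * P / 2))) := by
  have : Nonempty (Fin N × Fin P) := ⟨(⟨0, hN⟩, ⟨0, hP⟩)⟩
  refine (lintegral_mono fun x => ENNReal.ofReal_le_ofReal
    (spectralNormMat_entryMatrix_le_frobenius x)).trans ?_
  have h := integral_sqrt_dotProduct_piGaussian (ι := Fin N × Fin P)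
  simp only [Fintype.card_prod, Fintype.card_fin, Nat.cast_mul] at h
  rw [← h, ofReal_integral_eq_lintegral_ofReal _ (ae_of_all _ fun x => Real.sqrt_nonneg _)]
  refine (integrable_exp_mul_sqrt 1).mono' continuous_sqrt_dotProduct_self.aestronglyMeasurable
    (ae_of_all _ fun x => ?_)
  rw [Real.norm_of_nonneg (Real.sqrt_nonneg _), one_mul]
  linarith [Real.add_one_le_exp √(x ⬝ᵥ x)]

lemma entryMatrix_smul (c : ℝ) (x : Fin N × Fin P → ℝ) :
    entryMatrix (c • x) = (c : ℂ) • entryMatrix x := by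
  ext n p
  simp [entryMatrix]

/-- The expected dual norm of a Gaussian matrix with entries of standard deviation `s`. -/
lemma lintegral_gpDualNorm_le (hN : 2 ≤ N) (hP : 1 ≤ P) (ξ : ℝ) {Ce s t : ℝ} (hCe : 0 ≤ Ce)
    (hs : 0 ≤ s) (ht : 0 ≤ t) :
    ∫⁻ x, gpDualNorm ξ Ce (entryMatrix (s • x)) ∂piGaussian (Fin N × Fin P) ≤
      ENNReal.ofReal (min (bdOne N P s) (bdTwo N P s t) * Ce +
        s * √(4 * N * P * Real.log N)) := by
  choose T hT hTi hTE using fun p : Fin P => exists_column_majorant hN p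
  have hN0 : (0 : ℝ) < N := by exact_mod_cast (by omega : 0 < N)
  have hP0 : (0 : ℝ) < P := by exact_mod_cast hP
  have hlog : 0 < Real.log N := Real.log_pos (by exact_mod_cast (by omega : 1 < N))
  have hT0 : ∀ p x, 0 ≤ T p x := fun p x => (sq_nonneg _).trans (hT p x 1 (by simp))
  set m := min (√2 * (Real.Gamma (((N : ℝ) * P + 1) / 2) / Real.Gamma ((N : ℝ) * P / 2)))
    (√(N : ℝ) + √(P : ℝ) + t) with hm
  have hm0 : 0 ≤ m := by
    have h1 : 0 ≤ Real.Gamma (((N : ℝ) * P + 1) / 2) := Real.Gamma_nonneg_of_nonneg (by positivity)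
    have h2 : 0 ≤ Real.Gamma ((N : ℝ) * P / 2) := Real.Gamma_nonneg_of_nonneg (by positivity)
    exact le_min (by positivity) (by positivity)
  have hpt : ∀ x : Fin N × Fin P → ℝ, gpDualNorm ξ Ce (entryMatrix (s • x)) ≤
      ENNReal.ofReal (s * Ce) * ENNReal.ofReal (spectralNormMat (entryMatrix x)) +
        ENNReal.ofReal s * ENNReal.ofReal √(∑ p, T p x) := fun x => by
    have h1 := gpDualNorm_le (ξ := ξ) (Q := s * √(∑ p, T p x)) hCe (U := entryMatrix (s • x))
      fun θ => by
        rw [entryMatrix_smul, Matrix.conjTranspose_smul, Matrix.smul_mulVec, WithLp.toLp_smul,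
          norm_smul]
        simp only [RCLike.star_def, Complex.conj_ofReal, Complex.norm_real, Real.norm_eq_abs,
          abs_of_nonneg hs]
        exact mul_le_mul_of_nonneg_left
          (norm_conjTranspose_entryMatrix_mulVec_le (fun p z hz => hT p x z hz) ξ θ) hs
    refine h1.trans (le_of_eq ?_)
    have h2 := spectralNormMat_nonneg (entryMatrix x)
    rw [entryMatrix_smul, spectralNormMat_smul, abs_of_nonneg hs,
      ← ENNReal.ofReal_mul (by positivity), ← ENNReal.ofReal_mul hs,
      ← ENNReal.ofReal_add (by positivity) (by positivity)]
    ring_nf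
  have hspec : ∫⁻ x, ENNReal.ofReal (spectralNormMat (entryMatrix x))
      ∂piGaussian (Fin N × Fin P) ≤ ENNReal.ofReal m := by
    -- The mean is at most `√N + √P`; the extra `t ≥ 0` in the second bound is only given away here.
    rw [hm, ENNReal.ofReal_min]
    refine le_min (lintegral_spectralNormMat_le_gamma (by omega) (by omega))
      ((lintegral_spectralNormMat_le (by omega) (by omega)).trans
        (ENNReal.ofReal_le_ofReal (by linarith)))
  have hcol : ∫⁻ x, ENNReal.ofReal √(∑ p, T p x) ∂piGaussian (Fin N × Fin P) ≤
      ENNReal.ofReal √(4 * N * P * Real.log N) := by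
    refine lintegral_sqrt_le (integrable_finsetSum _ fun p _ => hTi p)
      (fun x => Finset.sum_nonneg fun p _ => hT0 p x) (by positivity) ?_
    rw [integral_finsetSum _ fun p _ => hTi p]
    refine (Finset.sum_le_sum fun p _ => hTE p).trans (le_of_eq ?_)
    simp; ring
  refine (lintegral_mono hpt).trans ?_
  have hmeas : Measurable fun x : Fin N × Fin P → ℝ =>
      ENNReal.ofReal (spectralNormMat (entryMatrix x)) :=
    continuous_spectralNormMat_entryMatrix.measurable.ennreal_ofReal
  rw [lintegral_add_left (hmeas.const_mul _), lintegral_const_mul _ hmeas,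
    lintegral_const_mul' _ _ ENNReal.ofReal_ne_top]
  refine (add_le_add (mul_le_mul_right hspec _) (mul_le_mul_right hcol _)).trans (le_of_eq ?_)
  have hmin : min (bdOne N P s) (bdTwo N P s t) = s * m := by
    rw [hm, mul_min_of_nonneg _ _ hs, bdOne, bdTwo]
    congr 1 <;> ring
  rw [hmin, ← ENNReal.ofReal_mul (by positivity), ← ENNReal.ofReal_mul hs,
    ← ENNReal.ofReal_add (by positivity) (by positivity)]
  ring_nf

/-- The joint law of independent centred Gaussian variables of variance `σ²`. -/
lemma map_eq_map_smul_piGaussian {Ω ι : Type*} [MeasurableSpace Ω] [Fintype ι] {μ : Measure Ω}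
    [IsProbabilityMeasure μ] {σ : ℝ≥0} {Y : ι → Ω → ℝ}
    (hlaw : ∀ i, HasLaw (Y i) (gaussianReal 0 (σ ^ 2)) μ) (hindep : iIndepFun Y μ) :
    μ.map (fun ω i => Y i ω) = (piGaussian ι).map (fun x => (σ : ℝ) • x) := by
  rw [(iIndepFun_iff_map_fun_eq_pi_map fun i => (hlaw i).aemeasurable).1 hindep]
  have h : ∀ i, μ.map (Y i) = (gaussianReal 0 1).map (fun y => (σ : ℝ) * y) := fun i => by
    rw [(hlaw i).map_eq, gaussianReal_map_const_mul]
    congr 1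
    · simp
    · ext; simp
  simp only [h]
  rw [piGaussian]
  exact (Measure.pi_map_pi (fun _ => (measurable_const_mul (σ : ℝ)).aemeasurable)).symm

end GaussianMatrix

end

/-! ### Transfer to an arbitrary probability space. -/

theorem proposition3 {Ω : Type*} [MeasurableSpace Ω] (μ : Measure Ω) [IsProbabilityMeasure μ]
    (N P : ℕ) (hN : 2 ≤ N) (hP : 1 ≤ P) (ξ Ce : ℝ) (hCe : 0 ≤ Ce) (σ : ℝ≥0)
    (W : Ω → Matrix (Fin N) (Fin P) ℝ)
    (hlaw : ∀ n p, HasLaw (fun ω => W ω n p) (gaussianReal 0 (σ ^ 2)) μ)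
    (hindep : iIndepFun (fun (i : Fin N × Fin P) (ω : Ω) => W ω i.1 i.2) μ)
    (t : ℝ) (ht : 0 ≤ t) :
    AEMeasurable (fun ω => gpDualNorm ξ Ce ((W ω).map Complex.ofReal)) μ ∧
    ∫⁻ ω, gpDualNorm ξ Ce ((W ω).map Complex.ofReal) ∂μ ≤
      ENNReal.ofReal (min (bdOne N P σ) (bdTwo N P σ t) * Ce +
        σ * √(4 * N * P * Real.log N)) ∧
    1 - 2 * Real.exp (-t ^ 2 / 2) <
      μ.real {ω | spectralNormMat ((W ω).map Complex.ofReal) ≤ bdTwo N P σ t} := by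
  set Y : Ω → Fin N × Fin P → ℝ := fun ω i => W ω i.1 i.2 with hY
  have hYm : AEMeasurable Y μ := aemeasurable_pi_lambda _ fun i => (hlaw i.1 i.2).aemeasurable
  have hmap : μ.map Y = (piGaussian (Fin N × Fin P)).map (fun x => (σ : ℝ) • x) :=
    map_eq_map_smul_piGaussian (fun i => hlaw i.1 i.2) hindep
  have hW : ∀ ω, (W ω).map Complex.ofReal = entryMatrix (Y ω) := fun ω => rfl
  have hsm : Measurable fun x : Fin N × Fin P → ℝ => (σ : ℝ) • x := measurable_const_smul _
  have hF := measurable_gpDualNorm_entryMatrix (N := N) (P := P) ξ Ce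
  simp only [hW]
  refine ⟨hF.comp_aemeasurable hYm, ?_, ?_⟩
  · rw [← lintegral_map' hF.aemeasurable hYm, hmap, lintegral_map hF hsm]
    exact lintegral_gpDualNorm_le hN hP ξ hCe σ.2 ht
  · have hclosed : MeasurableSet {x : Fin N × Fin P → ℝ |
        spectralNormMat (entryMatrix x) ≤ bdTwo N P σ t} :=
      (isClosed_le continuous_spectralNormMat_entryMatrix continuous_const).measurableSet
    have h1 : μ.real {ω | spectralNormMat (entryMatrix (Y ω)) ≤ bdTwo N P σ t} =
        (piGaussian (Fin N × Fin P)).real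
          {x | spectralNormMat (entryMatrix ((σ : ℝ) • x)) ≤ bdTwo N P σ t} := by
      have h2 := congrArg (fun ν => ν {x : Fin N × Fin P → ℝ |
        spectralNormMat (entryMatrix x) ≤ bdTwo N P σ t}) hmap
      rw [Measure.map_apply_of_aemeasurable hYm hclosed, Measure.map_apply hsm hclosed] at h2
      exact congrArg ENNReal.toReal h2
    have h2 : {x : Fin N × Fin P → ℝ | √(N : ℝ) + √(P : ℝ) + t <
        spectralNormMat (entryMatrix x)}ᶜ ⊆
        {x | spectralNormMat (entryMatrix ((σ : ℝ) • x)) ≤ bdTwo N P σ t} := fun x hx => by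
      have hx' : spectralNormMat (entryMatrix x) ≤ √(N : ℝ) + √(P : ℝ) + t := not_lt.1 hx
      simp only [Set.mem_ofPred_eq, entryMatrix_smul, spectralNormMat_smul, bdTwo, NNReal.abs_eq]
      rw [mul_comm]
      exact mul_le_mul_of_nonneg_right hx' σ.2
    have hopen : MeasurableSet {x : Fin N × Fin P → ℝ | √(N : ℝ) + √(P : ℝ) + t <
        spectralNormMat (entryMatrix x)} :=
      (isOpen_lt continuous_const continuous_spectralNormMat_entryMatrix).measurableSet
    have h3 := measureReal_mono (μ := piGaussian (Fin N × Fin P)) h2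
    rw [probReal_compl_eq_one_sub hopen] at h3
    have h4 : (piGaussian (Fin N × Fin P)).real {x | √(N : ℝ) + √(P : ℝ) + t <
        spectralNormMat (entryMatrix x)} ≤ Real.exp (-t ^ 2 / 2) :=
      ENNReal.toReal_le_of_le_ofReal (Real.exp_nonneg _)
        (piGaussian_spectralNormMat_tail (by omega) (by omega) ht)
    rw [h1]
    -- The one-sided tail gives `1 - exp (-t²/2)`, and positivity of the exponential makes the
    -- inequality with the factor 2 strict.
    linarith [Real.exp_pos (-t ^ 2 / 2)]
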